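/- Let $p$ be a prime, $m\ge 1$ and $r=p^m$. Assume $3\mid\frac{r-1}{p-1}$ and write $r-1=3n$. Let $\alpha$ be a primitive element of $\mathbb{F}_r$ and let $C_i=\alpha^i\langle\alpha^3\rangle$ for $i=0,1,2$ be the cyclotomic classes of order $3$. Let $I\subset\{0,1,2\}$ with $\#I=2$ and $D=\bigcup_{i\in I}C_i$. Let $$C_D=\{(\mathrm{Tr}(xd))_{d\in D}:x\in\mathbb{F}_r\},$$ where $\mathrm{Tr}$ is the trace from $\mathbb{F}_r$ to $\mathbb{F}_p$. For a code $C$ over $\mathbb{F}_p$, the complete weight enumerator is $$\mathrm{CWE}(C)=\sum_{\mathsf c\in C}\ \prod_{\rho\in\mathbb{F}_p}w_\rho^{k_\rho(\mathsf c)},$$ where the $w_\rho$ are indeterminates and $k_\rho(\mathsf c)$ is the number of coordinates of $\mathsf c$ equal to $\rho$. Then $C_D$ is a $[2n,m]$ linear code over $\mathbb{F}_p$ (length $2n$, dimension $m$), and its complete weight enumerator is as follows; all exponents that occur are nonnegative integers. (a) If $p\equiv1\pmod 3$ and $m\equiv0\pmod 3$, then there are integers $s_1,t_1$ with $4r^{1/3}=s_1^2+27t_1^2$,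 $s_1\equiv1\pmod 3$ and $\gcd(s_1,p)=1$, and for all such $s_1,t_1$ $$\begin{aligned}\mathrm{CWE}(C_D)=w_0^{2n}&+n\,w_0^{\frac{2n}{p}-\frac{p-1}{6p}(4-(s_1-9t_1)r^{1/3})}\prod_{\rho=1}^{p-1}w_\rho^{\frac{2n}{p}+\frac1{6p}(4-(s_1-9t_1)r^{1/3})}\\&+n\,w_0^{\frac{2n}{p}-\frac{p-1}{3p}(2+s_1r^{1/3})}\prod_{\rho=1}^{p-1}w_\rho^{\frac{2n}{p}+\frac1{3p}(2+s_1r^{1/3})}\\&+n\,w_0^{\frac{2n}{p}-\frac{p-1}{6p}(4-(s_1+9t_1)r^{1/3})}\prod_{\rho=1}^{p-1}w_\rho^{\frac{2n}{p}+\frac1{6p}(4-(s_1+9t_1)r^{1/3})}.\end{aligned}$$ (b) If $p\equiv2\pmod 3$ and $m\equiv0\pmod 4$, then $$\mathrm{CWE}(C_D)=w_0^{2n}+2n\,w_0^{\frac{2n}{p}-\frac{p-1}{3p}(2+\sqrt r)}\prod_{\rho=1}^{p-1}w_\rho^{\frac{2n}{p}+\frac1{3p}(2+\sqrt r)}+n\,w_0^{\frac{2n}{p}-\frac{2(p-1)}{3p}(1-\sqrt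 r)}\prod_{\rho=1}^{p-1}w_\rho^{\frac{2n}{p}+\frac2{3p}(1-\sqrt r)}.$$ (c) If $p\equiv2\pmod 3$ and $m\equiv2\pmod 4$, then $$\mathrm{CWE}(C_D)=w_0^{2n}+2n\,w_0^{\frac{2n}{p}-\frac{p-1}{3p}(2-\sqrt r)}\prod_{\rho=1}^{p-1}w_\rho^{\frac{2n}{p}+\frac1{3p}(2-\sqrt r)}+n\,w_0^{\frac{2n}{p}-\frac{2(p-1)}{3p}(1+\sqrt r)}\prod_{\rho=1}^{p-1}w_\rho^{\frac{2n}{p}+\frac2{3p}(1+\sqrt r)}.$$ -/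

import Mathlib

namespace CyclotomicCode

/-- The cyclotomic class `C_i = α ^ i ⟨α ^ N⟩` of order `N`, as a subset of the field `F`. -/
def cyclotomicClass {F : Type*} [Field F] (α : Fˣ) (N i : ℕ) : Set F :=
  {x | ∃ u ∈ Subgroup.zpowers (α ^ N), x = ((α ^ i * u : Fˣ) : F)}

/-- The defining set `D = ⋃ i ∈ I, C_i`, where `I ⊆ {0, …, N - 1}`. -/
def definingSet {F : Type*} [Field F] (α : Fˣ) (N : ℕ) (I : Finset (Fin N)) : Set F :=
  ⋃ i ∈ I, cyclotomicClass α N (i : ℕ)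

/-- The code `C_D = {(Tr (x d))_{d ∈ D} : x ∈ F}`; coordinates are indexed by `D` itself, so the
length of the code is the number of elements of `D`. -/
noncomputable def traceCode (p : ℕ) [Fact p.Prime] {F : Type*} [Field F] [Algebra (ZMod p) F]
    (D : Set F) : Submodule (ZMod p) (D → ZMod p) where
  carrier := {c | ∃ x : F, c = fun d : D => Algebra.trace (ZMod p) F (x * (d : F))}
  add_mem' := by
    rintro _ _ ⟨x, rfl⟩ ⟨y, rfl⟩
    refine ⟨x + y, ?_⟩
    funext d
    simp [add_mul]
  zero_mem' := ⟨0, by funext d; simp⟩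
  smul_mem' := by
    rintro a _ ⟨x, rfl⟩
    refine ⟨a • x, ?_⟩
    funext d
    simp

/-- `C` is an `[n, k]` linear code over `ZMod p`: it has length `n` and dimension `k`. -/
def IsLinearCode {p : ℕ} [Fact p.Prime] {ι : Type*} (C : Submodule (ZMod p) (ι → ZMod p))
    (n k : ℕ) : Prop :=
  Nat.card ι = n ∧ Module.finrank (ZMod p) C = k

/-- The monomial `∏ ρ, w_ρ ^ (number of coordinates of c equal to ρ)`, with `w_ρ = X ρ`. -/
noncomputable def wordEnumerator {p : ℕ} [Fact p.Prime] {ι : Type*} (c : ι → ZMod p) :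
    MvPolynomial (ZMod p) ℤ :=
  ∏ ρ : ZMod p, MvPolynomial.X ρ ^ {i : ι | c i = ρ}.ncard

/-- The complete weight enumerator of a code: the sum of `wordEnumerator c` over all `c ∈ C`. -/
noncomputable def CWE {p : ℕ} [Fact p.Prime] {ι : Type*} [Finite ι]
    (C : Submodule (ZMod p) (ι → ZMod p)) : MvPolynomial (ZMod p) ℤ :=
  ∑ c ∈ (Set.toFinite (C : Set (ι → ZMod p))).toFinset, wordEnumerator c

/-- The monomial `w_0 ^ a * ∏_{ρ ≠ 0} w_ρ ^ b`. -/
noncomputable def weightMonomial (p : ℕ) [Fact p.Prime] (a b : ℕ) : MvPolynomial (ZMod p) ℤ :=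
  MvPolynomial.X 0 ^ a * ∏ ρ ∈ Finset.univ.erase (0 : ZMod p), MvPolynomial.X ρ ^ b

/-- The conditions on the integers `s`, `t`:
`4 r^(1/3) = s ^ 2 + 27 t ^ 2`, `s ≡ 1 (mod 3)` and `gcd (s, p) = 1`. -/
def IsCubicPair (p r : ℕ) (s t : ℤ) : Prop :=
  4 * (r : ℝ) ^ (1 / 3 : ℝ) = (s : ℝ) ^ 2 + 27 * (t : ℝ) ^ 2 ∧ s ≡ 1 [ZMOD 3] ∧
    Int.gcd s (p : ℤ) = 1

end CyclotomicCode

namespace CyclotomicCode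

open Finset

/-! ### Sums over the field through powers of a generator, and cosets of the cubes. -/

section Generator

variable {F : Type*} [Field F] [Fintype F] {α : Fˣ} {n : ℕ}

/-! Everything reduces to the cubic periods `η(x) = ∑ y, ψ(x y³)`, with `ψ` the canonical additive
character. As 3 divides `(r-1)/(p-1)`, every nonzero element of the prime field is a cube in `F`. So
`Tr(x y³)` takes all nonzero values equally often, and `η(x)` is an integer (`cubicPeriod_eq_sum`).
For `x ≠ 0` the three class periods sum to zero, so if `C_k` is the class missing from `D`, each
nonzero value occurs `(2r + η(x α^k)) / (3p)` times in the word of `x` (`ncard_coord_eq`). The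
enumerator depends only on the multiset of the three periods.

That multiset is found from power sums. By orthogonality these count zeros of diagonal cubic forms
(`sum_cubicPeriod_pow`): the sum is 0, the square sum is `6r`, and the product `xyz` satisfies
`3n·xyz = r(N - r²)`, where `N` counts the zeros of `X³ + Y³ + Z³`. Each period is also `1` modulo
3.

If `p ≡ 2 (mod 3)` and `r = p^(2l)`, the form `x² + xy + y²` is anisotropic modulo `p`. Descent
gives `p^l` times a triple of square sum 6, and the congruence modulo 3 fixes the sign. If `p ≡ 1
(mod 3)` and `r = p^(3k)`, a Chevalley–Warning computation and Lucas' theorem give `p ∤ N`. So the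
product has valuation exactly `3k`, and the periods are `p^k` times integers prime to `p`. Such a
triple amounts to a representation `4p^k = s² + 27t²`, unique up to the sign of `t`
(`cubic_pair_unique`). -/

theorem orderOf_generator (hα : ∀ x : Fˣ, x ∈ Subgroup.zpowers α)
    (hq : Fintype.card F = n * 3 + 1) : orderOf α = n * 3 := by
  rw [orderOf_eq_card_of_forall_mem_zpowers hα, Nat.card_units, Nat.card_eq_fintype_card, hq]
  simp

theorem generator_pow_injOn (hα : ∀ x : Fˣ, x ∈ Subgroup.zpowers α)
    (hq : Fintype.card F = n * 3 + 1) :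
    Set.InjOn (fun l : ℕ => α ^ l) (range (n * 3) : Set ℕ) := by
  have h := pow_injOn_Iio_orderOf (x := α)
  rw [orderOf_generator hα hq] at h
  intro a ha b hb hab
  exact h (by simpa using ha) (by simpa using hb) hab

theorem sum_eq_zero_add_sum_generator_pow {M : Type*} [AddCommMonoid M]
    (hα : ∀ x : Fˣ, x ∈ Subgroup.zpowers α) (hq : Fintype.card F = n * 3 + 1) (f : F → M) :
    ∑ x, f x = f 0 + ∑ l ∈ range (n * 3), f ((α ^ l : Fˣ) : F) := by
  classical
  have h1 : ∑ x, f x = f 0 + ∑ u : Fˣ, f (u : F) := by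
    rw [Fintype.sum_eq_add_sum_compl 0 f]
    congr 1
    refine (Finset.sum_bij (fun (u : Fˣ) _ => (u : F)) ?_ ?_ ?_ ?_).symm
    · intro u _; simp
    · intro u _ v _ h; exact Units.ext h
    · intro x hx
      exact ⟨Units.mk0 x (by simpa using hx), by simp, by simp⟩
    · intro u _; rfl
  rw [h1, ← IsCyclic.image_range_orderOf hα, orderOf_generator hα hq,
    Finset.sum_image (generator_pow_injOn hα hq)]

theorem sum_range_mul_three {M : Type*} [AddCommMonoid M] (f : ℕ → M) (n : ℕ) :
    ∑ l ∈ range (n * 3), f l = ∑ j ∈ range n, ∑ i ∈ range 3, f (i + 3 * j) := by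
  induction n with
  | zero => simp
  | succ n ih =>
    rw [Nat.succ_mul, Finset.sum_range_add, ih, Finset.sum_range_succ _ n, mul_comm n 3]
    simp only [add_comm (3 * n)]

/-- Cubing is three-to-one on a cyclic group of order `3n`: shifting `l` by `n` leaves `α ^ (3 * l)`
unchanged. -/
theorem sum_generator_pow_cube {M : Type*} [AddCommMonoid M]
    (hα : ∀ x : Fˣ, x ∈ Subgroup.zpowers α) (hq : Fintype.card F = n * 3 + 1) (f : Fˣ → M) :
    ∑ l ∈ range (n * 3), f ((α ^ l) ^ 3) = 3 • ∑ j ∈ range n, f (α ^ (3 * j)) := by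
  have key : ∀ l, f ((α ^ (n + l)) ^ 3) = f (α ^ (3 * l)) := by
    intro l
    have h : α ^ (n * 3) = 1 := by rw [← orderOf_generator hα hq, pow_orderOf_eq_one]
    rw [← pow_mul, add_mul, pow_add, h, one_mul, mul_comm]
  have key' : ∀ l, f ((α ^ l) ^ 3) = f (α ^ (3 * l)) := by
    intro l
    rw [← pow_mul, mul_comm]
  have key2 : ∀ l, f ((α ^ (n + n + l)) ^ 3) = f (α ^ (3 * l)) := by
    intro l
    rw [add_assoc, key, ← key', key]
  rw [show n * 3 = n + n + n by ring, Finset.sum_range_add, Finset.sum_range_add]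
  simp_rw [key2, key, key']
  rw [succ_nsmul, two_nsmul]

theorem sum_of_mul_cube_invariant {M : Type*} [AddCommMonoid M]
    (hα : ∀ x : Fˣ, x ∈ Subgroup.zpowers α) (hq : Fintype.card F = n * 3 + 1) (f : F → M)
    (hf : ∀ (x : F) (u : Fˣ), f (x * (u : F) ^ 3) = f x) :
    ∑ x, f x = f 0 + n • ∑ i ∈ range 3, f ((α ^ i : Fˣ) : F) := by
  rw [sum_eq_zero_add_sum_generator_pow hα hq, sum_range_mul_three]
  congr 1
  rw [← Finset.card_range n, ← Finset.sum_const, Finset.card_range]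
  refine Finset.sum_congr rfl fun j _ => Finset.sum_congr rfl fun i _ => ?_
  rw [← hf ((α ^ i : Fˣ) : F) (α ^ j)]
  congr 1
  push_cast
  ring

theorem mem_cyclotomicClass_iff (hα : ∀ x : Fˣ, x ∈ Subgroup.zpowers α)
    (hq : Fintype.card F = n * 3 + 1) (i : ℕ) (x : F) :
    x ∈ cyclotomicClass α 3 i ↔ ∃ j < n, x = ((α ^ (i + 3 * j) : Fˣ) : F) := by
  classical
  have hn : 0 < n := by
    have := Fintype.one_lt_card (α := F)
    omega
  constructor
  · rintro ⟨u, hu, rfl⟩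
    have hfin : IsOfFinOrder (α ^ 3) := isOfFinOrder_of_finite _
    rw [hfin.mem_zpowers_iff_mem_range_orderOf, orderOf_pow' _ (by norm_num),
      orderOf_generator hα hq, Nat.gcd_mul_left_left] at hu
    obtain ⟨j, hj, rfl⟩ := Finset.mem_image.1 hu
    refine ⟨j, by simpa using hj, ?_⟩
    rw [pow_add, pow_mul]
  · rintro ⟨j, _, rfl⟩
    exact ⟨(α ^ 3) ^ j, ⟨j, by simp⟩, by rw [pow_add, pow_mul]⟩

/-- Each element of `C_i` is `α^i y³` for exactly three nonzero `y`. This turns coordinate counts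
into counts of cubic values. -/
theorem three_mul_ncard_definingSet [DecidableEq F] (hα : ∀ x : Fˣ, x ∈ Subgroup.zpowers α)
    (hq : Fintype.card F = n * 3 + 1) (I : Finset (Fin 3)) (P : F → Prop) [DecidablePred P] :
    3 * {d : definingSet α 3 I | P d}.ncard
      = ∑ i ∈ I, #{y : F | y ≠ 0 ∧ P (((α ^ (i : ℕ) : Fˣ) : F) * y ^ 3)} := by
  classical
  have hinj : Set.InjOn (fun z : Fin 3 × ℕ => ((α ^ ((z.1 : ℕ) + 3 * z.2) : Fˣ) : F))
      (I ×ˢ range n : Finset (Fin 3 × ℕ)) := by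
    rintro ⟨i, j⟩ hij ⟨i', j'⟩ hij' h
    simp only [coe_product, Set.mem_prod, mem_coe, mem_range] at hij hij'
    have hi := i.isLt
    have hi' := i'.isLt
    have := generator_pow_injOn hα hq (by simp; omega) (by simp; omega) (Units.ext h)
    simp only at this
    refine Prod.ext (Fin.ext ?_) ?_ <;> simp only <;> omega
  have h1 : {d : definingSet α 3 I | P d}.ncard
      = #(((I ×ˢ range n).image
          (fun z : Fin 3 × ℕ => ((α ^ ((z.1 : ℕ) + 3 * z.2) : Fˣ) : F))).filter P) := by
    rw [← Set.ncard_image_of_injective _ Subtype.val_injective, ← Set.ncard_coe_finset]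
    congr 1
    ext x
    simp only [Set.mem_image, Set.mem_ofPred_eq, Subtype.exists, exists_and_right, exists_eq_right,
      coe_filter, Finset.mem_image, mem_product, mem_range, Prod.exists, definingSet,
      Set.mem_iUnion, mem_cyclotomicClass_iff hα hq]
    constructor
    · rintro ⟨⟨i, hi, j, hj, rfl⟩, hP⟩
      exact ⟨⟨i, j, ⟨hi, hj⟩, rfl⟩, hP⟩
    · rintro ⟨⟨i, j, ⟨hi, hj⟩, rfl⟩, hP⟩
      exact ⟨⟨i, hi, j, hj, rfl⟩, hP⟩
  rw [h1, Finset.card_filter, Finset.sum_image hinj, Finset.sum_product, Finset.mul_sum]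
  refine Finset.sum_congr rfl fun i _ => ?_
  rw [Finset.card_filter, sum_eq_zero_add_sum_generator_pow hα hq]
  have := sum_generator_pow_cube hα hq
    (fun u : Fˣ => if P (((α ^ (i : ℕ) : Fˣ) : F) * (u : F)) then 1 else 0)
  simp only [ne_eq, not_true_eq_false, false_and, if_false, Units.ne_zero, not_false_eq_true,
    true_and, zero_add]
  push_cast at this ⊢
  rw [this, smul_eq_mul]
  congr 1
  refine Finset.sum_congr rfl fun j _ => ?_
  simp only [pow_add]

/-- The units of the prime field are the powers of `α` whose exponent is a multiple of
`(r-1)/(p-1)`, hence of 3. -/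
theorem algebraMap_eq_cube {p : ℕ} [Fact p.Prime] [Algebra (ZMod p) F]
    (hα : ∀ x : Fˣ, x ∈ Subgroup.zpowers α) (hN : 3 ∣ (Fintype.card F - 1) / (p - 1))
    (hp : p - 1 ∣ Fintype.card F - 1) (u : ZMod p) (hu : u ≠ 0) :
    ∃ v : Fˣ, algebraMap (ZMod p) F u = (v : F) ^ 3 := by
  have hu' : algebraMap (ZMod p) F u ≠ 0 := by simpa using hu
  obtain ⟨j, hj⟩ := (isOfFinOrder_of_finite α).mem_powers_iff_mem_zpowers.2
    (hα (Units.mk0 _ hu'))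
  have hj : α ^ j = Units.mk0 _ hu' := hj
  have h1 : α ^ (j * (p - 1)) = 1 := by
    rw [pow_mul, hj]
    ext
    simp only [Units.val_pow_eq_pow_val, Units.val_mk0, Units.val_one]
    rw [← map_pow, ZMod.pow_card_sub_one_eq_one hu, map_one]
  have h2 := orderOf_dvd_of_pow_eq_one h1
  rw [orderOf_eq_card_of_forall_mem_zpowers hα, Nat.card_units, Nat.card_eq_fintype_card] at h2
  have hp0 : 0 < p - 1 := Nat.sub_pos_of_lt (Fact.out : p.Prime).one_lt
  have h3 : 3 ∣ j := by
    refine hN.trans ?_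
    obtain ⟨c, hc⟩ := hp
    rw [hc, Nat.mul_div_cancel_left _ hp0]
    rw [hc, mul_comm j] at h2
    exact Nat.dvd_of_mul_dvd_mul_left hp0 h2
  obtain ⟨l, rfl⟩ := h3
  refine ⟨α ^ l, ?_⟩
  have := congrArg (fun x : Fˣ => (x : F)) hj
  simp only [Units.val_mk0] at this
  rw [← this]
  push_cast
  ring

end Generator

/-! ### Cubic periods: integrality and power sums. -/

section Period

variable (p : ℕ) [Fact p.Prime] {F : Type*} [Field F] [Algebra (ZMod p) F]

variable (F) in
/-- The canonical additive character of a finite field. -/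
noncomputable def traceAddChar : AddChar F ℂ :=
  (ZMod.stdAddChar (N := p)).compAddMonoidHom (Algebra.trace (ZMod p) F).toAddMonoidHom

theorem traceAddChar_apply (x : F) :
    traceAddChar p F x = ZMod.stdAddChar (Algebra.trace (ZMod p) F x) := rfl

variable [Fintype F]

/-- The number of `y` with `Tr (x * y ^ 3) = ρ`. -/
noncomputable def cubicTraceCount (x : F) (ρ : ZMod p) : ℕ :=
  #{y : F | Algebra.trace (ZMod p) F (x * y ^ 3) = ρ}

/-- The integer `∑ y, ψ (x * y ^ 3)`, where `ψ` is the canonical additive character, whenever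
the number of `y` with `Tr (x * y ^ 3) = ρ` is the same for all `ρ ≠ 0`. -/
noncomputable def cubicPeriod (x : F) : ℤ :=
  cubicTraceCount p x 0 - cubicTraceCount p x 1

theorem isPrimitive_traceAddChar : (traceAddChar p F).IsPrimitive := by
  refine AddChar.IsPrimitive.of_ne_one (AddChar.ne_one_iff.2 ?_)
  obtain ⟨x, hx⟩ := Algebra.trace_surjective (ZMod p) F 1
  refine ⟨x, ?_⟩
  rw [traceAddChar_apply, hx]
  intro h
  have := ZMod.injective_stdAddChar (h.trans (AddChar.map_zero_eq_one _).symm)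
  exact one_ne_zero this

theorem cubicTraceCount_mul_cube (x : F) (u : Fˣ) (ρ : ZMod p) :
    cubicTraceCount p (x * (u : F) ^ 3) ρ = cubicTraceCount p x ρ := by
  unfold cubicTraceCount
  refine Finset.card_bij (fun y _ => u * y) ?_ ?_ ?_
  · intro y hy
    simp only [mem_filter, mem_univ, true_and] at hy ⊢
    rw [← hy, mul_pow, mul_assoc]
  · intro y _ z _ h
    exact mul_left_cancel₀ u.ne_zero h
  · intro y hy
    refine ⟨(u⁻¹ : Fˣ) * y, ?_, by simp⟩
    simp only [mem_filter, mem_univ, true_and] at hy ⊢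
    rw [← hy, mul_assoc, ← mul_pow, Units.mul_inv_cancel_left]

theorem cubicPeriod_mul_cube (x : F) (u : Fˣ) :
    cubicPeriod p (x * (u : F) ^ 3) = cubicPeriod p x := by
  simp only [cubicPeriod, cubicTraceCount_mul_cube]

/-- If every nonzero element of the prime field is a cube, then the counts at nonzero values
coincide. -/
theorem cubicTraceCount_eq_one
    (hc : ∀ u : ZMod p, u ≠ 0 → ∃ v : Fˣ, algebraMap (ZMod p) F u = (v : F) ^ 3)
    (x : F) {ρ : ZMod p} (hρ : ρ ≠ 0) : cubicTraceCount p x ρ = cubicTraceCount p x 1 := by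
  obtain ⟨v, hv⟩ := hc ρ hρ
  rw [← cubicTraceCount_mul_cube p x v]
  unfold cubicTraceCount
  congr 1
  ext y
  simp only [mem_filter, mem_univ, true_and]
  rw [← hv, mul_right_comm, mul_comm _ (algebraMap (ZMod p) F ρ), ← Algebra.smul_def, map_smul,
    smul_eq_mul]
  exact mul_eq_left₀ hρ

theorem sum_cubicTraceCount (x : F) : ∑ ρ, cubicTraceCount p x ρ = Fintype.card F := by
  unfold cubicTraceCount
  rw [← Finset.card_eq_sum_card_fiberwise (fun _ _ => by simp)]
  simp

theorem cubicPeriod_eq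
    (hc : ∀ u : ZMod p, u ≠ 0 → ∃ v : Fˣ, algebraMap (ZMod p) F u = (v : F) ^ 3) (x : F) :
    cubicPeriod p x = Fintype.card F - p * cubicTraceCount p x 1 := by
  have h := sum_cubicTraceCount p x
  rw [← Finset.add_sum_erase _ _ (mem_univ 0), Finset.sum_congr rfl
    (fun ρ hρ => cubicTraceCount_eq_one p hc x (Finset.ne_of_mem_erase hρ)), Finset.sum_const,
    Finset.card_erase_of_mem (mem_univ _), card_univ, ZMod.card, smul_eq_mul] at h
  have hp := (Fact.out : p.Prime).one_le
  rw [cubicPeriod, ← h]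
  push_cast [Nat.cast_sub hp]
  ring

theorem cubicPeriod_zero : cubicPeriod p (0 : F) = Fintype.card F := by
  simp [cubicPeriod, cubicTraceCount]

/-- All nonzero traces occur equally often and the nontrivial values of the character on `ZMod p`
sum to `-1`, so the sum collapses to a difference of two counts. -/
theorem cubicPeriod_eq_sum
    (hc : ∀ u : ZMod p, u ≠ 0 → ∃ v : Fˣ, algebraMap (ZMod p) F u = (v : F) ^ 3) (x : F) :
    (cubicPeriod p x : ℂ) = ∑ y : F, traceAddChar p F (x * y ^ 3) := by
  have h1 : ∑ y : F, traceAddChar p F (x * y ^ 3)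
      = ∑ ρ : ZMod p, (cubicTraceCount p x ρ : ℂ) * ZMod.stdAddChar ρ := by
    rw [← Finset.sum_fiberwise _ (fun y => Algebra.trace (ZMod p) F (x * y ^ 3))]
    refine Finset.sum_congr rfl fun ρ _ => ?_
    rw [cubicTraceCount, ← nsmul_eq_mul, ← Finset.sum_const]
    refine Finset.sum_congr rfl fun y hy => ?_
    rw [traceAddChar_apply, (mem_filter.1 hy).2]
  have h2 : ∑ ρ : ZMod p, ZMod.stdAddChar (N := p) ρ = 0 := by
    refine AddChar.sum_eq_zero_of_ne_one (AddChar.ne_one_iff.2 ⟨1, fun h => ?_⟩)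
    exact one_ne_zero (ZMod.injective_stdAddChar (h.trans (AddChar.map_zero_eq_one _).symm))
  rw [← Finset.add_sum_erase _ _ (mem_univ 0), AddChar.map_zero_eq_one] at h2
  rw [h1, ← Finset.add_sum_erase _ _ (mem_univ 0), AddChar.map_zero_eq_one, Finset.sum_congr rfl
    (fun ρ hρ => by rw [cubicTraceCount_eq_one p hc x (Finset.ne_of_mem_erase hρ)]),
    ← Finset.mul_sum, eq_neg_of_add_eq_zero_right h2, cubicPeriod]
  push_cast
  ring

/-- Expand the power and sum over `x` first: orthogonality keeps only the tuples whose cubes sum to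
zero. -/
theorem sum_cubicPeriod_pow [DecidableEq F]
    (hc : ∀ u : ZMod p, u ≠ 0 → ∃ v : Fˣ, algebraMap (ZMod p) F u = (v : F) ^ 3) (k : ℕ) :
    ∑ x : F, cubicPeriod p x ^ k
      = Fintype.card F * #{v : Fin k → F | ∑ i, v i ^ 3 = 0} := by
  have h : ∀ x : F, (cubicPeriod p x : ℂ) ^ k
      = ∑ v : Fin k → F, traceAddChar p F (x * ∑ i, v i ^ 3) := by
    intro x
    rw [cubicPeriod_eq_sum p hc, Fintype.sum_pow]
    refine Finset.sum_congr rfl fun v _ => ?_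
    rw [Finset.mul_sum]
    exact (map_prod (traceAddChar p F).toMonoidHom _ _).symm
  have h2 : (∑ x : F, (cubicPeriod p x : ℂ) ^ k)
      = Fintype.card F * #{v : Fin k → F | ∑ i, v i ^ 3 = 0} := by
    simp_rw [h]
    rw [Finset.sum_comm]
    simp_rw [AddChar.sum_mulShift _ (isPrimitive_traceAddChar p)]
    rw [Finset.card_filter]
    push_cast
    rw [Finset.mul_sum]
    simp
  exact_mod_cast h2

end Period

/-! ### Zeros of diagonal cubic forms in two and three variables. -/

section Counting

theorem sum_fin_succ_arrow {F M : Type*} [Fintype F] [AddCommMonoid M] (k : ℕ) (f : (Fin (k + 1) → F) → M) :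
    ∑ v, f v = ∑ x, ∑ w : Fin k → F, f (Fin.cons x w) := by
  rw [← Fintype.sum_prod_type']
  exact (Fintype.sum_equiv (Fin.consEquiv fun _ => F) _ _ fun _ => rfl).symm

variable {F : Type*} [Field F] [Fintype F] {α : Fˣ} {n : ℕ}

theorem pos_of_card_eq (hq : Fintype.card F = n * 3 + 1) : 0 < n := by
  have := Fintype.one_lt_card (α := F)
  omega

theorem sum_ite_cube_eq_cube [DecidableEq F] (hα : ∀ x : Fˣ, x ∈ Subgroup.zpowers α)
    (hq : Fintype.card F = n * 3 + 1) {z : F} (hz : z ≠ 0) :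
    (∑ y : F, if y ^ 3 = z ^ 3 then 1 else 0) = 3 := by
  have hn := pos_of_card_eq hq
  have h0 : α ^ (n * 3) = 1 := by rw [← orderOf_generator hα hq, pow_orderOf_eq_one]
  obtain ⟨l, hl⟩ := (isOfFinOrder_of_finite α).mem_powers_iff_mem_zpowers.2 (hα (Units.mk0 z hz))
  have hl : α ^ l = Units.mk0 z hz := hl
  rw [sum_eq_zero_add_sum_generator_pow hα hq]
  have h := sum_generator_pow_cube hα hq (fun u : Fˣ => if (u : F) = z ^ 3 then 1 else 0)
  push_cast at h ⊢
  rw [h, if_neg (by simpa using (pow_ne_zero 3 hz).symm), zero_add, smul_eq_mul,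
    Finset.sum_eq_single (l % n)]
  · rw [if_pos]
    have : α ^ (3 * (l % n)) = (Units.mk0 z hz) ^ 3 := by
      rw [← hl, ← pow_mul, mul_comm l 3]
      conv_rhs => rw [← Nat.mod_add_div l n]
      rw [mul_add, pow_add, ← mul_assoc, mul_comm 3 n, pow_mul α (n * 3), h0, one_pow, mul_one]
    simpa using congrArg (fun u : Fˣ => (u : F)) this
  · intro j hj hne
    rw [if_neg]
    intro hjz
    apply hne
    have h1 : α ^ (3 * j) = α ^ (3 * l) := by
      rw [mul_comm 3 l, pow_mul α l, hl]
      ext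
      simpa using hjz
    rw [pow_inj_mod, orderOf_generator hα hq, mul_comm n 3, Nat.mul_mod_mul_left,
      Nat.mul_mod_mul_left] at h1
    rw [← Nat.mod_eq_of_lt (mem_range.1 hj)]
    omega
  · intro h
    exact absurd (mem_range.2 (Nat.mod_lt _ hn)) h

/-- Since `-1` is a cube, each of the `3n` nonzero values of one variable allows three of the other;
the origin adds one. -/
theorem card_sum_two_cubes_eq_zero [DecidableEq F] (hα : ∀ x : Fˣ, x ∈ Subgroup.zpowers α)
    (hq : Fintype.card F = n * 3 + 1) :
    #{v : Fin 2 → F | ∑ i, v i ^ 3 = 0} = 9 * n + 1 := by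
  have h : ∀ y z : F, z ^ 3 + y ^ 3 = 0 ↔ y ^ 3 = (-z) ^ 3 := by
    intro y z
    rw [Odd.neg_pow (by decide), eq_neg_iff_add_eq_zero, add_comm]
  rw [Finset.card_filter, sum_fin_succ_arrow]
  simp_rw [sum_fin_succ_arrow]
  simp only [univ_unique, Fin.sum_univ_two, Fin.cons_zero, Fin.cons_one, sum_singleton, h]
  rw [sum_eq_zero_add_sum_generator_pow hα hq, Finset.sum_congr rfl (fun l _ =>
    sum_ite_cube_eq_cube hα hq (neg_ne_zero.2 (α ^ l).ne_zero))]
  simp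
  ring

theorem sum_pow_three_mul (hq : Fintype.card F = n * 3 + 1) (a : ℕ) :
    ∑ x : F, x ^ (3 * a) = if n ∣ a ∧ a ≠ 0 then -1 else 0 := by
  classical
  by_cases ha : a = 0
  · subst ha
    have : ((Fintype.card F : ℕ) : F) = 0 := FiniteField.cast_card_eq_zero F
    simp [this]
  · have h1 : ∑ x : F, x ^ (3 * a) = ∑ u : Fˣ, (u : F) ^ (3 * a) := by
      rw [Fintype.sum_eq_add_sum_compl 0, zero_pow (by omega), zero_add]
      refine (Finset.sum_bij (fun (u : Fˣ) _ => (u : F)) ?_ ?_ ?_ ?_).symm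
      · intro u _; simp
      · intro u _ v _ h; exact Units.ext h
      · intro x hx
        exact ⟨Units.mk0 x (by simpa using hx), by simp, by simp⟩
      · intro u _; rfl
    rw [h1, FiniteField.sum_pow_units, hq, Nat.add_sub_cancel, mul_comm n 3]
    exact if_congr ⟨fun h => ⟨Nat.dvd_of_mul_dvd_mul_left (by norm_num) h, ha⟩,
      fun h => Nat.mul_dvd_mul_left 3 h.1⟩ rfl rfl

/-- In the binomial expansion only the powers of `x ^ 3` with exponent a positive multiple of `n`
have nonzero sum, namely `-1`; the index `c` stands for the multiple `(c + 1) * n`. -/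
theorem sum_cube_add_pow (hq : Fintype.card F = n * 3 + 1) (w : F) (k : ℕ) :
    ∑ x : F, (x ^ 3 + w) ^ (k * n)
      = - ∑ c ∈ range k, w ^ ((k - (c + 1)) * n) * ((k * n).choose ((c + 1) * n) : F) := by
  have hn := pos_of_card_eq hq
  simp_rw [add_pow, ← pow_mul]
  rw [Finset.sum_comm]
  simp_rw [mul_assoc, ← Finset.sum_mul, sum_pow_three_mul hq]
  rw [← Finset.sum_neg_distrib]
  have hinj : Set.InjOn (fun c => (c + 1) * n) (range k : Set ℕ) := by
    intro a _ b _ h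
    simpa using Nat.eq_of_mul_eq_mul_right hn h
  rw [← Finset.sum_subset (s₁ := (range k).image (fun c => (c + 1) * n)), Finset.sum_image hinj]
  · refine Finset.sum_congr rfl fun c _ => ?_
    rw [if_pos ⟨Dvd.intro_left _ rfl, by positivity⟩, neg_one_mul, Nat.sub_mul]
  · intro a ha
    obtain ⟨c, hc, rfl⟩ := Finset.mem_image.1 ha
    rw [mem_range] at hc ⊢
    exact Nat.lt_succ_of_le (Nat.mul_le_mul_right n hc)
  · intro a ha hna
    rw [if_neg, zero_mul]
    rintro ⟨⟨c, rfl⟩, hc⟩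
    apply hna
    have hc0 : c ≠ 0 := by rintro rfl; simp at hc
    rw [mem_range, Nat.lt_succ_iff, mul_comm] at ha
    have := Nat.le_of_mul_le_mul_right ha hn
    exact Finset.mem_image.2 ⟨c - 1, by rw [mem_range]; omega,
      by rw [Nat.sub_add_cancel (by omega), mul_comm]⟩

/-- As in Chevalley–Warning, the indicator of `s = 0` is `1 - s^(r-1)`. Only the monomial with all
three cubes to the power `n` survives, and its multinomial coefficient is the product of binomials.
-/
theorem card_sum_three_cubes_eq_zero [DecidableEq F] (hq : Fintype.card F = n * 3 + 1) :
    ((#{v : Fin 3 → F | ∑ i, v i ^ 3 = 0} : ℕ) : F)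
      = ((3 * n).choose n * (2 * n).choose n : ℕ) := by
  have hn := pos_of_card_eq hq
  have hcard : ((Fintype.card F : ℕ) : F) = 0 := FiniteField.cast_card_eq_zero F
  have hz : ∑ z : F, z ^ (n * 3) = -1 := by
    rw [mul_comm, sum_pow_three_mul hq, if_pos ⟨dvd_rfl, hn.ne'⟩]
  have h1 : ∀ s : F, (if s = 0 then (1 : F) else 0) = 1 - s ^ (3 * n) := by
    intro s
    split_ifs with hs
    · rw [hs, zero_pow (by omega), sub_zero]
    · have := FiniteField.pow_card_sub_one_eq_one s hs
      rw [hq, Nat.add_sub_cancel, mul_comm] at this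
      rw [this, sub_self]
  rw [Finset.card_filter]
  push_cast
  simp_rw [sum_fin_succ_arrow, h1]
  simp only [univ_unique, Fin.sum_univ_three, Fin.cons_zero, Fin.cons_one, sum_singleton,
    Finset.sum_sub_distrib]
  have e2 : ∀ x y z : F, (Fin.cons x (Fin.cons y (Fin.cons z default)) : Fin 3 → F) 2 = z :=
    fun _ _ _ => rfl
  have e2' : ∀ x y z : F, x ^ 3 + y ^ 3 + z ^ 3 = z ^ 3 + (y ^ 3 + x ^ 3) :=
    fun _ _ _ => by ring
  simp only [e2, e2']
  simp_rw [sum_cube_add_pow hq]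
  simp only [Finset.sum_range_succ, Finset.sum_range_zero, Finset.sum_neg_distrib,
    Finset.sum_add_distrib, ← Finset.sum_mul]
  rw [show (3 - (0 + 1)) * n = 2 * n by norm_num, show (3 - (1 + 1)) * n = 1 * n by norm_num,
    show (3 - (2 + 1)) * n = 0 by norm_num]
  simp_rw [sum_cube_add_pow hq]
  simp only [Finset.sum_range_succ, Finset.sum_range_zero, Finset.sum_neg_distrib,
    Finset.sum_add_distrib, ← Finset.sum_mul]
  simp [hcard, hz, ← pow_mul, mul_comm]

end Counting

/-! ### Symmetric functions of the three periods. -/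

section Moments

variable (p : ℕ) [Fact p.Prime] {F : Type*} [Field F] [Fintype F] [Algebra (ZMod p) F]
  {α : Fˣ} {n : ℕ}

theorem moment_cubicPeriod [DecidableEq F] (hα : ∀ x : Fˣ, x ∈ Subgroup.zpowers α)
    (hq : Fintype.card F = n * 3 + 1)
    (hc : ∀ u : ZMod p, u ≠ 0 → ∃ v : Fˣ, algebraMap (ZMod p) F u = (v : F) ^ 3) (k : ℕ) :
    ((n * 3 + 1 : ℕ) : ℤ) ^ k + n * ∑ i ∈ range 3, cubicPeriod p ((α ^ i : Fˣ) : F) ^ k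
      = (n * 3 + 1 : ℕ) * #{v : Fin k → F | ∑ i, v i ^ 3 = 0} := by
  rw [← hq, ← sum_cubicPeriod_pow p hc, sum_of_mul_cube_invariant hα hq
    (fun x => cubicPeriod p x ^ k) (fun x u => by simp only [cubicPeriod_mul_cube]),
    cubicPeriod_zero, nsmul_eq_mul]

theorem sum_cubicPeriod_generator (hα : ∀ x : Fˣ, x ∈ Subgroup.zpowers α)
    (hq : Fintype.card F = n * 3 + 1)
    (hc : ∀ u : ZMod p, u ≠ 0 → ∃ v : Fˣ, algebraMap (ZMod p) F u = (v : F) ^ 3) :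
    ∑ i ∈ range 3, cubicPeriod p ((α ^ i : Fˣ) : F) = 0 := by
  classical
  have hn : (n : ℤ) ≠ 0 := by exact_mod_cast (pos_of_card_eq hq).ne'
  have h := moment_cubicPeriod p hα hq hc 1
  have h1 : #{v : Fin 1 → F | ∑ i, v i ^ 3 = 0} = 1 := by
    rw [Finset.card_filter, sum_fin_succ_arrow]
    simp
  simp only [h1, pow_one] at h
  refine mul_left_cancel₀ hn ?_
  push_cast at h ⊢
  linarith

theorem sum_cubicPeriod_generator_sq (hα : ∀ x : Fˣ, x ∈ Subgroup.zpowers α)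
    (hq : Fintype.card F = n * 3 + 1)
    (hc : ∀ u : ZMod p, u ≠ 0 → ∃ v : Fˣ, algebraMap (ZMod p) F u = (v : F) ^ 3) :
    ∑ i ∈ range 3, cubicPeriod p ((α ^ i : Fˣ) : F) ^ 2 = 6 * (n * 3 + 1 : ℕ) := by
  classical
  have hn : (n : ℤ) ≠ 0 := by exact_mod_cast (pos_of_card_eq hq).ne'
  have h := moment_cubicPeriod p hα hq hc 2
  rw [card_sum_two_cubes_eq_zero hα hq] at h
  refine mul_left_cancel₀ hn ?_
  push_cast at h ⊢
  linarith

/-- For three numbers of sum zero, the sum of cubes is three times the product. -/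
theorem prod_cubicPeriod_generator [DecidableEq F] (hα : ∀ x : Fˣ, x ∈ Subgroup.zpowers α)
    (hq : Fintype.card F = n * 3 + 1)
    (hc : ∀ u : ZMod p, u ≠ 0 → ∃ v : Fˣ, algebraMap (ZMod p) F u = (v : F) ^ 3) :
    ((n * 3 + 1 : ℕ) : ℤ) ^ 3 + 3 * n * (cubicPeriod p ((α ^ 0 : Fˣ) : F)
        * cubicPeriod p ((α ^ 1 : Fˣ) : F) * cubicPeriod p ((α ^ 2 : Fˣ) : F))
      = (n * 3 + 1 : ℕ) * #{v : Fin 3 → F | ∑ i, v i ^ 3 = 0} := by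
  have h1 := sum_cubicPeriod_generator p hα hq hc
  rw [← moment_cubicPeriod p hα hq hc 3]
  simp only [sum_range_succ, sum_range_zero, zero_add] at h1 ⊢
  rw [eq_neg_of_add_eq_zero_right h1]
  ring

/-- All base-`p` digits of `n = (p^m - 1)/3` equal `d = (p-1)/3`, and those of `2n` and `3n` are
`2d` and `3d`, still below `p`. By Lucas both binomials are products of units modulo `p`. -/
theorem not_dvd_choose_mul_choose (hp : p ≡ 1 [MOD 3]) (m : ℕ) :
    ∀ n, n * 3 + 1 = p ^ m → ¬ p ∣ (3 * n).choose n * (2 * n).choose n := by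
  have hpp := (Fact.out : p.Prime)
  induction m with
  | zero =>
    intro n hn
    obtain rfl : n = 0 := by simpa using hn
    simpa using hpp.one_lt.ne'
  | succ m ih =>
    intro n hn
    obtain ⟨d, hd⟩ : ∃ d, p = 3 * d + 1 := ⟨p / 3, by have := hp; unfold Nat.ModEq at this; omega⟩
    obtain ⟨k, hk⟩ : ∃ k, p ^ m = 3 * k + 1 :=
      ⟨p ^ m / 3, by have := hp.pow m; rw [one_pow] at this; unfold Nat.ModEq at this; omega⟩
    have hnk : n = d + p * k := by
      rw [pow_succ, hk] at hn
      have : 3 * n = 3 * (d + p * k) := by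
        zify at hn hd ⊢
        linear_combination hn + hd
      omega
    have aux : ∀ c ≤ 3, (c * n) % p = c * d ∧ (c * n) / p = c * k := by
      intro c hc
      have hcd : c * d < p := by
        have := Nat.mul_le_mul_right d hc
        omega
      rw [show c * n = c * d + p * (c * k) by rw [hnk]; ring]
      exact ⟨by rw [Nat.add_mul_mod_self_left, Nat.mod_eq_of_lt hcd],
        by rw [Nat.add_mul_div_left _ _ hpp.pos, Nat.div_eq_of_lt hcd, zero_add]⟩
    have key : ∀ c ≤ 3, ¬ p ∣ (c * k).choose k → 1 ≤ c → ¬ p ∣ (c * n).choose n := by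
      intro c hc h hc1
      have h1 := Choose.choose_modEq_choose_mod_mul_choose_div_nat (p := p) (n := c * n) (k := n)
      obtain ⟨e1, e2⟩ := aux 1 (by norm_num)
      simp only [one_mul] at e1 e2
      rw [(aux c hc).1, (aux c hc).2, e1, e2] at h1
      rw [h1.dvd_iff dvd_rfl, hpp.dvd_mul, not_or]
      refine ⟨?_, h⟩
      exact hpp.coprime_iff_not_dvd.1 (hpp.coprime_choose_of_lt (by
        have := Nat.mul_le_mul_right d hc
        omega) (Nat.le_mul_of_pos_left d hc1))
    have h := ih k (by omega)
    rw [hpp.dvd_mul, not_or] at h ⊢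
    exact ⟨key 3 le_rfl h.1 (by norm_num), key 2 (by norm_num) h.2 (by norm_num)⟩

theorem not_dvd_card_sum_three_cubes_eq_zero [DecidableEq F] (hp : p ≡ 1 [MOD 3]) {m : ℕ}
    (hm : n * 3 + 1 = p ^ m) (hq : Fintype.card F = n * 3 + 1) :
    ¬ p ∣ #{v : Fin 3 → F | ∑ i, v i ^ 3 = 0} := by
  have h := card_sum_three_cubes_eq_zero hq
  rw [← map_natCast (algebraMap (ZMod p) F), ← map_natCast (algebraMap (ZMod p) F)] at h
  have h := (algebraMap (ZMod p) F).injective h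
  rw [← CharP.cast_eq_zero_iff (ZMod p) p, h, CharP.cast_eq_zero_iff (ZMod p) p]
  exact not_dvd_choose_mul_choose p hp m n hm

end Moments

/-! ### Integral triples of sum zero with prescribed square sum. -/

section Arithmetic

theorem multiset_cons_rotate {β : Type*} (a b c : β) :
    ({a, b, c} : Multiset β) = {b, c, a} := by
  rw [show ({a, b, c} : Multiset β) = a ::ₘ b ::ₘ {c} from rfl,
    show ({b, c, a} : Multiset β) = b ::ₘ c ::ₘ {a} from rfl, Multiset.cons_swap,
    ← Multiset.singleton_add c {a}, add_comm]
  rfl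

theorem multiset_cons_swap_right {β : Type*} (a b c : β) :
    ({a, b, c} : Multiset β) = {a, c, b} := congrArg (a ::ₘ ·) (Multiset.pair_comm b c)

/-- `X ^ 2 + X + 1` has no root modulo a prime `p ≡ 2 (mod 3)`. -/
theorem dvd_of_dvd_sq_add_mul_add_sq {p : ℕ} (hp : p.Prime) (h3 : p ≡ 2 [MOD 3]) {x y : ℤ}
    (h : (p : ℤ) ∣ x ^ 2 + x * y + y ^ 2) : (p : ℤ) ∣ y := by
  have := Fact.mk hp
  rw [← ZMod.intCast_zmod_eq_zero_iff_dvd] at h ⊢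
  push_cast at h
  by_contra hy
  set u : ZMod p := (x : ZMod p) / y with hu
  have hu2 : u ^ 2 + u + 1 = 0 := by
    rw [hu]
    field_simp
    linear_combination h
  have hu3 : u ^ 3 = 1 := by linear_combination (u - 1) * hu2
  have hu0 : u ≠ 0 := by
    intro h0
    rw [h0] at hu3
    simp at hu3
  have hp3 : p = 3 * (p / 3) + 2 := by unfold Nat.ModEq at h3; omega
  have h1 := ZMod.pow_card_sub_one_eq_one hu0
  -- Since `p - 1 ≡ 1 (mod 3)`, Fermat turns the cube root of unity `u` into 1; then `u² + u + 1 =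
  -- 0` reads `3 = 0`.
  rw [show p - 1 = 3 * (p / 3) + 1 by omega, pow_add, pow_mul, hu3, one_pow, one_mul, pow_one] at h1
  rw [h1] at hu2
  have : ((3 : ℕ) : ZMod p) = 0 := by
    push_cast
    linear_combination hu2
  rw [CharP.cast_eq_zero_iff (ZMod p) p, Nat.prime_dvd_prime_iff_eq hp Nat.prime_three] at this
  omega

/-- Integral triples of sum zero with square sum `6 * p ^ (2 * l)`, `p ≡ 2 (mod 3)`, are multiples
of `p ^ l`. -/
theorem exists_eq_pow_mul_of_two_mod_three {p : ℕ} (hp : p.Prime) (h3 : p ≡ 2 [MOD 3])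
    (l : ℕ) : ∀ x y z : ℤ, x + y + z = 0 → x ^ 2 + y ^ 2 + z ^ 2 = 6 * (p : ℤ) ^ (2 * l) →
    ∃ a b c : ℤ, x = p ^ l * a ∧ y = p ^ l * b ∧ z = p ^ l * c ∧ a + b + c = 0 ∧
      a ^ 2 + b ^ 2 + c ^ 2 = 6 := by
  have hp0 : (p : ℤ) ≠ 0 := by exact_mod_cast hp.ne_zero
  induction l with
  | zero =>
    intro x y z h h'
    exact ⟨x, y, z, by simp, by simp, by simp, h, by simpa using h'⟩
  | succ l ih =>
    intro x y z h h'
    obtain rfl : z = -(x + y) := by linarith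
    have hd : x ^ 2 + x * y + y ^ 2 = p * (p * 3 * (p : ℤ) ^ (2 * l)) := by
      have : 2 * (x ^ 2 + x * y + y ^ 2) = 2 * (p * (p * 3 * (p : ℤ) ^ (2 * l))) := by
        linear_combination h'
      linarith
    obtain ⟨y', rfl⟩ := dvd_of_dvd_sq_add_mul_add_sq hp h3 ⟨_, hd⟩
    obtain ⟨x', rfl⟩ := dvd_of_dvd_sq_add_mul_add_sq hp h3 (x := p * y') (y := x)
      ⟨_, by rw [← hd]; ring⟩
    obtain ⟨a, b, c, ha, hb, hc', h1, h2⟩ := ih x' y' (-(x' + y')) (by ring) (by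
      have h4 : (p : ℤ) ^ 2 ≠ 0 := pow_ne_zero 2 hp0
      refine mul_left_cancel₀ h4 ?_
      linear_combination h')
    exact ⟨a, b, c, by rw [ha]; ring, by rw [hb]; ring,
      by linear_combination (p : ℤ) * hc', h1, h2⟩

/-- Without the congruences the solutions are the permutations of `±(1, 1, -2)`; being 1 modulo 3
selects the sign. -/
theorem multiset_eq_of_sum_sq_eq_six {a b c : ℤ} (h : a + b + c = 0)
    (h2 : a ^ 2 + b ^ 2 + c ^ 2 = 6) (ha : a ≡ 1 [ZMOD 3]) (hb : b ≡ 1 [ZMOD 3]) :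
    ({a, b, c} : Multiset ℤ) = {1, 1, -2} := by
  have ha1 : a ≤ 2 := by nlinarith
  have ha2 : -2 ≤ a := by nlinarith
  have hb1 : b ≤ 2 := by nlinarith
  have hb2 : -2 ≤ b := by nlinarith
  obtain rfl : c = -(a + b) := by linarith
  unfold Int.ModEq at ha hb
  have ha' : a = 1 ∨ a = -2 := by omega
  have hb' : b = 1 ∨ b = -2 := by omega
  rcases ha' with rfl | rfl <;> rcases hb' with rfl | rfl <;> first | decide | (norm_num at h2)

/-- After `p^l` is divided out, the sign `(-1)^l` comes from `p ≡ -1 (mod 3)`. -/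
theorem multiset_eq_of_two_mod_three {p l : ℕ} (hp : p.Prime) (h3 : p ≡ 2 [MOD 3])
    {x y z : ℤ} (h : x + y + z = 0) (h' : x ^ 2 + y ^ 2 + z ^ 2 = 6 * (p : ℤ) ^ (2 * l))
    (hx : x ≡ 1 [ZMOD 3]) (hy : y ≡ 1 [ZMOD 3]) :
    ({x, y, z} : Multiset ℤ)
      = {(-1) ^ l * (p : ℤ) ^ l, (-1) ^ l * (p : ℤ) ^ l, -(2 * ((-1) ^ l * (p : ℤ) ^ l))} := by
  obtain ⟨a, b, c, rfl, rfl, rfl, h1, h2⟩ :=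
    exists_eq_pow_mul_of_two_mod_three hp h3 l x y z h h'
  have hp1 : (p : ℤ) ≡ -1 [ZMOD 3] := by
    have := Int.natCast_modEq_iff.2 h3
    unfold Int.ModEq at this ⊢
    push_cast at this
    omega
  have hs : ((-1 : ℤ) ^ l) * (-1) ^ l = 1 := by rw [← mul_pow]; simp
  have hpl : (p : ℤ) ^ l ≡ (-1) ^ l [ZMOD 3] := hp1.pow l
  have key : ∀ a : ℤ, (p : ℤ) ^ l * a ≡ 1 [ZMOD 3] → (-1) ^ l * a ≡ 1 [ZMOD 3] := fun a ha =>
    (hpl.symm.mul_right a).trans ha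
  have hm := multiset_eq_of_sum_sq_eq_six (a := (-1) ^ l * a) (b := (-1) ^ l * b)
    (c := (-1) ^ l * c) (by linear_combination (-1 : ℤ) ^ l * h1)
    (by linear_combination h2 + (a ^ 2 + b ^ 2 + c ^ 2) * hs) (key a hx) (key b hy)
  have hm := congrArg (Multiset.map fun t => ((-1) ^ l * (p : ℤ) ^ l) * t) hm
  simp only [Multiset.insert_eq_cons, Multiset.map_cons, Multiset.map_singleton] at hm ⊢
  have e : ∀ a : ℤ, (-1) ^ l * (p : ℤ) ^ l * ((-1) ^ l * a) = p ^ l * a := fun a => by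
    linear_combination (p : ℤ) ^ l * a * hs
  rw [e, e, e] at hm
  rw [hm, mul_one, mul_neg, mul_comm _ (2 : ℤ)]

/-- A triple of sum zero and square sum divisible by a prime `p ≠ 2`, one of whose members is
divisible by `p`, is divisible by `p`. -/
theorem dvd_of_sum_eq_zero_of_dvd_sum_sq {p : ℕ} (hp : p.Prime) (hp2 : p ≠ 2) {a b c : ℤ}
    (h : a + b + c = 0) (h2 : (p : ℤ) ∣ a ^ 2 + b ^ 2 + c ^ 2) (ha : (p : ℤ) ∣ a) :
    (p : ℤ) ∣ b ∧ (p : ℤ) ∣ c := by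
  have hpp : Prime (p : ℤ) := Nat.prime_iff_prime_int.1 hp
  have hb : (p : ℤ) ∣ 2 * b ^ 2 := by
    have : 2 * b ^ 2 = (a ^ 2 + b ^ 2 + c ^ 2) - a * (2 * a + 2 * b) := by
      obtain rfl : c = -(a + b) := by linarith
      ring
    rw [this]
    exact dvd_sub h2 (ha.mul_right _)
  have hb' : (p : ℤ) ∣ b := by
    rcases hpp.dvd_mul.1 hb with h' | h'
    · have : p ∣ 2 := by exact_mod_cast h'
      exact absurd ((Nat.prime_dvd_prime_iff_eq hp Nat.prime_two).1 this) hp2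
    · exact hpp.dvd_of_dvd_pow h'
  refine ⟨hb', ?_⟩
  obtain rfl : c = -(a + b) := by linarith
  exact (dvd_neg).2 (dvd_add ha hb')

/-- An integral triple of sum zero, with square sum `6 * p ^ (3 * k)` and whose product has
`p`-adic valuation `3 * k`, is `p ^ k` times a triple of members prime to `p`. -/
theorem exists_eq_pow_mul_of_prod_valuation {p : ℕ} (hp : p.Prime) (hp2 : p ≠ 2) (k : ℕ) :
    -- Dividing the triple by `p` lowers the exponent in the square sum by 2 and in the product by
    -- 3. Hence the free `e`, set to `k` in the application.
    ∀ (e : ℕ) (x y z u w : ℤ), x + y + z = 0 →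
      x ^ 2 + y ^ 2 + z ^ 2 = 6 * (p : ℤ) ^ (2 * k + e) →
      x * y * z * u = (p : ℤ) ^ (3 * k) * w → ¬ (p : ℤ) ∣ u → ¬ (p : ℤ) ∣ w →
      ∃ a b c : ℤ, x = p ^ k * a ∧ y = p ^ k * b ∧ z = p ^ k * c ∧ a + b + c = 0 ∧
        a ^ 2 + b ^ 2 + c ^ 2 = 6 * (p : ℤ) ^ e ∧ ¬ (p : ℤ) ∣ a ∧ ¬ (p : ℤ) ∣ b ∧
        ¬ (p : ℤ) ∣ c := by
  have hp0 : (p : ℤ) ≠ 0 := by exact_mod_cast hp.ne_zero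
  have hpp : Prime (p : ℤ) := Nat.prime_iff_prime_int.1 hp
  induction k with
  | zero =>
    intro e x y z u w h h2 h3 hu hw
    rw [mul_zero, pow_zero, one_mul] at h3
    refine ⟨x, y, z, by simp, by simp, by simp, h, by simpa using h2, ?_, ?_, ?_⟩ <;> intro hd <;>
      apply hw <;> rw [← h3]
    · exact ((hd.mul_right _).mul_right _).mul_right _
    · exact ((hd.mul_left _).mul_right _).mul_right _
    · exact (hd.mul_left _).mul_right _
  | succ k ih =>
    intro e x y z u w h h2 h3 hu hw
    have hd2 : (p : ℤ) ∣ x ^ 2 + y ^ 2 + z ^ 2 := by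
      rw [h2]
      exact (dvd_pow_self _ (by omega)).mul_left _
    have hd3 : (p : ℤ) ∣ x * y * z * u := by
      rw [h3]
      exact (dvd_pow_self _ (by omega)).mul_right _
    have hall : (p : ℤ) ∣ x ∧ (p : ℤ) ∣ y ∧ (p : ℤ) ∣ z := by
      rcases hpp.dvd_mul.1 hd3 with hd | hd
      · rcases hpp.dvd_mul.1 hd with hd | hd
        · rcases hpp.dvd_mul.1 hd with hd | hd
          · exact ⟨hd, dvd_of_sum_eq_zero_of_dvd_sum_sq hp hp2 h hd2 hd⟩
          · have := dvd_of_sum_eq_zero_of_dvd_sum_sq hp hp2 (a := y) (b := z) (c := x)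
              (by linarith) (by rwa [show y ^ 2 + z ^ 2 + x ^ 2 = x ^ 2 + y ^ 2 + z ^ 2 by ring]) hd
            exact ⟨this.2, hd, this.1⟩
        · have := dvd_of_sum_eq_zero_of_dvd_sum_sq hp hp2 (a := z) (b := x) (c := y)
            (by linarith) (by rwa [show z ^ 2 + x ^ 2 + y ^ 2 = x ^ 2 + y ^ 2 + z ^ 2 by ring]) hd
          exact ⟨this.1, this.2, hd⟩
      · exact absurd hd hu
    obtain ⟨⟨x', rfl⟩, ⟨y', rfl⟩, ⟨z', rfl⟩⟩ := hall
    obtain ⟨a, b, c, rfl, rfl, rfl, h'⟩ := ih e x' y' z' u w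
      (mul_left_cancel₀ hp0 (by linear_combination h))
      (mul_left_cancel₀ (pow_ne_zero 2 hp0) (by linear_combination h2))
      (mul_left_cancel₀ (pow_ne_zero 3 hp0) (by linear_combination h3)) hu hw
    exact ⟨a, b, c, by ring, by ring, by ring, h'⟩

/-- The representation `4 * P = s ^ 2 + 27 * t ^ 2` attached to a triple. -/
theorem exists_cubic_pair {p k : ℕ} (hp1 : (p : ℤ) ≡ 1 [ZMOD 3]) {a b c : ℤ}
    (h : a + b + c = 0) (h2 : a ^ 2 + b ^ 2 + c ^ 2 = 6 * (p : ℤ) ^ k)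
    (ha : a ≡ 1 [ZMOD 3]) (hb : b ≡ 1 [ZMOD 3]) (hpa : ¬ (p : ℤ) ∣ a) (hpb : ¬ (p : ℤ) ∣ b)
    (hpc : ¬ (p : ℤ) ∣ c) :
    ∃ s t v w : ℤ, 4 * (p : ℤ) ^ k = s ^ 2 + 27 * t ^ 2 ∧ s ≡ 1 [ZMOD 3] ∧ ¬ (p : ℤ) ∣ s ∧
      2 * v = -(s - 9 * t) ∧ 2 * w = -(s + 9 * t) ∧ ({a, b, c} : Multiset ℤ) = {v, s, w} := by
  have key : ∀ s v w : ℤ, s + v + w = 0 → s ^ 2 + v ^ 2 + w ^ 2 = 6 * (p : ℤ) ^ k →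
      (9 : ℤ) ∣ v - w → ∃ t, 4 * (p : ℤ) ^ k = s ^ 2 + 27 * t ^ 2 ∧ 2 * v = -(s - 9 * t) ∧
        2 * w = -(s + 9 * t) := by
    rintro s v w h h2 ⟨t, ht⟩
    obtain rfl : v = w + 9 * t := by linarith
    obtain rfl : s = -(2 * w + 9 * t) := by linarith
    refine ⟨t, ?_, by ring, by ring⟩
    linarith
  have hc : c ≡ 1 [ZMOD 3] := by unfold Int.ModEq at *; omega
  obtain ⟨P, hP⟩ : ∃ P : ℤ, (p : ℤ) ^ k = 1 + 3 * P := by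
    have := hp1.pow k
    rw [one_pow] at this
    exact ⟨(p ^ k - 1) / 3, by unfold Int.ModEq at this; omega⟩
  obtain ⟨a', rfl⟩ : ∃ a', a = 1 + 3 * a' := ⟨(a - 1) / 3, by unfold Int.ModEq at ha; omega⟩
  obtain ⟨b', rfl⟩ : ∃ b', b = 1 + 3 * b' := ⟨(b - 1) / 3, by unfold Int.ModEq at hb; omega⟩
  obtain rfl : c = 1 + 3 * (-1 - a' - b') := by linarith
  -- Three integers that are 1 modulo 3 and sum to zero include two congruent modulo 9. These become
  -- `v` and `w`, with `v - w = 9t`; the third is `s`.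
  have hcases : (3 : ℤ) ∣ a' - b' ∨ (3 : ℤ) ∣ b' - (-1 - a' - b') ∨
      (3 : ℤ) ∣ (-1 - a' - b') - a' := by
    have : (a' - b') % 3 = 0 ∨ (a' - b') % 3 = 1 ∨ (a' - b') % 3 = 2 := by omega
    rcases this with h3 | h3 | h3
    · exact Or.inl (by omega)
    · exact Or.inr (Or.inr (by omega))
    · exact Or.inr (Or.inl (by omega))
  rcases hcases with ⟨d, hd⟩ | ⟨d, hd⟩ | ⟨d, hd⟩
  · obtain ⟨t, h4, hv, hw⟩ := key (1 + 3 * (-1 - a' - b')) (1 + 3 * a') (1 + 3 * b')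
      (by ring) (by linarith) ⟨d, by linarith⟩
    exact ⟨_, t, _, _, h4, hc, hpc, hv, hw, multiset_cons_swap_right _ _ _⟩
  · obtain ⟨t, h4, hv, hw⟩ := key (1 + 3 * a') (1 + 3 * b') (1 + 3 * (-1 - a' - b'))
      (by ring) (by linarith) ⟨d, by linarith⟩
    exact ⟨_, t, _, _, h4, ha, hpa, hv, hw,
      (multiset_cons_rotate _ _ _).trans ((multiset_cons_swap_right _ _ _).trans rfl)⟩
  · obtain ⟨t, h4, hv, hw⟩ := key (1 + 3 * b') (1 + 3 * (-1 - a' - b')) (1 + 3 * a')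
      (by ring) (by linarith) ⟨d, by linarith⟩
    exact ⟨_, t, _, _, h4, hb, hpb, hv, hw,
      (multiset_cons_rotate _ _ _).trans ((multiset_cons_rotate _ _ _).trans
        (multiset_cons_swap_right _ _ _))⟩

/-- The representation `4 * p ^ k = s ^ 2 + 27 * t ^ 2` with `p` prime to `s` and
`s ≡ 1 (mod 3)` is unique up to the sign of `t`. -/
theorem cubic_pair_unique {p k : ℕ} (hp : p.Prime) (hp2 : p ≠ 2) (hk : k ≠ 0) {s t u v : ℤ}
    (h : 4 * (p : ℤ) ^ k = s ^ 2 + 27 * t ^ 2) (h' : 4 * (p : ℤ) ^ k = u ^ 2 + 27 * v ^ 2)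
    (hs : s ≡ 1 [ZMOD 3]) (hu : u ≡ 1 [ZMOD 3]) (hps : ¬ (p : ℤ) ∣ s) (hpu : ¬ (p : ℤ) ∣ u) :
    s = u ∧ (t = v ∨ t = -v) := by
  have hpp : Prime (p : ℤ) := Nat.prime_iff_prime_int.1 hp
  have hP : (0 : ℤ) < (p : ℤ) ^ k := pow_pos (by exact_mod_cast hp.pos) k
  have hpk : (p : ℤ) ∣ (p : ℤ) ^ k := dvd_pow_self _ hk
  have hprod : (p : ℤ) ^ k ∣ (s * v - u * t) * (s * v + u * t) :=
    ⟨4 * (v ^ 2 - t ^ 2), by linear_combination -v ^ 2 * h + t ^ 2 * h'⟩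
  -- So the whole of `p^k` divides a single factor of the product above.
  have hone : (p : ℤ) ∣ s * v - u * t → ¬ (p : ℤ) ∣ s * v + u * t := by
    intro h1 h2
    have h3 : (p : ℤ) ∣ 2 * (s * v) := by
      have := dvd_add h1 h2
      rwa [show s * v - u * t + (s * v + u * t) = 2 * (s * v) by ring] at this
    rcases hpp.dvd_mul.1 h3 with h4 | h4
    · have : p ∣ 2 := by exact_mod_cast h4
      exact hp2 ((Nat.prime_dvd_prime_iff_eq hp Nat.prime_two).1 this)
    · rcases hpp.dvd_mul.1 h4 with h5 | h5
      · exact hps h5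
      · apply hpu
        refine hpp.dvd_of_dvd_pow (n := 2) ?_
        rw [show u ^ 2 = 4 * (p : ℤ) ^ k - v * (27 * v) by linear_combination -h']
        exact dvd_sub (hpk.mul_left _) (h5.mul_right _)
  have hzero : ∀ v : ℤ, 4 * (p : ℤ) ^ k = u ^ 2 + 27 * v ^ 2 → (p : ℤ) ^ k ∣ s * v - u * t →
      s * v - u * t = 0 := by
    rintro v h' ⟨w, hw⟩
    -- Composition of the two forms: a multiple `p^k w` in the last square gives `27w² ≤ 16`, so `w
    -- = 0`.
    have h1 : 16 * ((p : ℤ) ^ k) ^ 2 = (s * u + 27 * t * v) ^ 2 + 27 * (s * v - u * t) ^ 2 := by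
      linear_combination 4 * (p : ℤ) ^ k * h + (s ^ 2 + 27 * t ^ 2) * h'
    rw [hw] at h1 ⊢
    have h2 : ((p : ℤ) ^ k) ^ 2 * (27 * w ^ 2) ≤ ((p : ℤ) ^ k) ^ 2 * 16 := by
      nlinarith [sq_nonneg (s * u + 27 * t * v)]
    have h3 := le_of_mul_le_mul_left h2 (by positivity)
    have h4 : w ^ 2 = 0 := by
      have := sq_nonneg w
      omega
    rw [pow_eq_zero_iff (by norm_num)] at h4
    rw [h4, mul_zero]
  have hsq : (s * v) ^ 2 = (u * t) ^ 2 := by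
    by_cases h1 : (p : ℤ) ∣ s * v - u * t
    · have hcop : IsCoprime ((p : ℤ) ^ k) (s * v + u * t) :=
        ((Prime.coprime_iff_not_dvd hpp).2 (hone h1)).pow_left
      have := hzero v h' (hcop.dvd_of_dvd_mul_right hprod)
      rw [sub_eq_zero.1 this]
    · have hcop : IsCoprime ((p : ℤ) ^ k) (s * v - u * t) :=
        ((Prime.coprime_iff_not_dvd hpp).2 h1).pow_left
      have h2 := hcop.dvd_of_dvd_mul_left hprod
      have := hzero (-v) (by rw [neg_sq]; exact h') (by
        rw [← dvd_neg]
        rwa [show -(s * -v - u * t) = s * v + u * t by ring])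
      linear_combination (u * t - s * v) * this
  have hvt : v ^ 2 = t ^ 2 := by
    have : 4 * (p : ℤ) ^ k * v ^ 2 = 4 * (p : ℤ) ^ k * t ^ 2 := by
      linear_combination hsq + v ^ 2 * h - t ^ 2 * h'
    exact mul_left_cancel₀ (by positivity) this
  have hsu : s ^ 2 = u ^ 2 := by linear_combination h' - h + 27 * hvt
  refine ⟨?_, sq_eq_sq_iff_eq_or_eq_neg.1 hvt.symm⟩
  rcases sq_eq_sq_iff_eq_or_eq_neg.1 hsu with h1 | h1
  · exact h1
  · unfold Int.ModEq at hs hu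
    omega

end Arithmetic

/-! ### Trace codes and word enumerators. -/

section Code

variable (p : ℕ) [Fact p.Prime] {F : Type*} [Field F] [Algebra (ZMod p) F]

/-- The encoding map `x ↦ (Tr (x d))_{d ∈ D}`. -/
noncomputable def traceEncoder (D : Set F) : F →ₗ[ZMod p] (D → ZMod p) where
  toFun x := fun d => Algebra.trace (ZMod p) F (x * (d : F))
  map_add' x y := by
    funext d
    simp [add_mul]
  map_smul' a x := by
    funext d
    simp

theorem range_traceEncoder (D : Set F) : LinearMap.range (traceEncoder p D) = traceCode p D := by
  ext c
  exact ⟨fun ⟨x, hx⟩ => ⟨x, hx.symm⟩, fun ⟨x, hx⟩ => ⟨x, hx.symm⟩⟩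

theorem CWE_traceCode [Fintype F] (D : Set F) (h : Function.Injective (traceEncoder p D)) :
    CWE (traceCode p D) = ∑ x, wordEnumerator (traceEncoder p D x) := by
  classical
  rw [CWE, ← Finset.sum_image (g := traceEncoder p D) (s := univ) (f := wordEnumerator) h.injOn]
  refine Finset.sum_congr ?_ fun _ _ => rfl
  ext c
  rw [Set.Finite.mem_toFinset, SetLike.mem_coe, ← range_traceEncoder]
  simp

/-- The inequality makes the natural subtraction in the exponent of `w_0` a true one. -/
theorem wordEnumerator_eq_weightMonomial {ι : Type*} [Finite ι] (c : ι → ZMod p) {b : ℕ}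
    (hb : ∀ ρ ≠ 0, {i | c i = ρ}.ncard = b) :
    (p - 1) * b ≤ Nat.card ι ∧
      wordEnumerator c = weightMonomial p (Nat.card ι - (p - 1) * b) b := by
  classical
  have := Fintype.ofFinite ι
  have h : ∑ ρ : ZMod p, {i | c i = ρ}.ncard = Nat.card ι := by
    rw [Nat.card_eq_fintype_card, ← Finset.card_univ,
      Finset.card_eq_sum_card_fiberwise (f := c) (t := univ) (fun _ _ => by simp)]
    refine Finset.sum_congr rfl fun ρ _ => ?_
    rw [← Set.ncard_coe_finset]
    simp
  rw [← Finset.add_sum_erase _ _ (mem_univ 0), Finset.sum_congr rfl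
    (fun ρ hρ => hb ρ (Finset.ne_of_mem_erase hρ)), Finset.sum_const,
    Finset.card_erase_of_mem (mem_univ _), card_univ, ZMod.card, smul_eq_mul] at h
  refine ⟨by omega, ?_⟩
  rw [wordEnumerator, weightMonomial, ← Finset.mul_prod_erase _ _ (mem_univ 0), ← h,
    Nat.add_sub_cancel]
  congr 1
  exact Finset.prod_congr rfl fun ρ hρ => by rw [hb ρ (Finset.ne_of_mem_erase hρ)]

theorem wordEnumerator_zero {ι : Type*} [Finite ι] :
    wordEnumerator (0 : ι → ZMod p) = MvPolynomial.X 0 ^ Nat.card ι := by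
  have h := (wordEnumerator_eq_weightMonomial p (0 : ι → ZMod p) (b := 0) (fun ρ hρ => by
    rw [Set.ncard_eq_zero]
    ext i
    simpa using hρ.symm)).2
  rw [h]
  simp [weightMonomial]

end Code

/-! ### Codeword compositions in terms of periods. -/

section Weights

variable (p : ℕ) [Fact p.Prime] {F : Type*} [Field F] [Fintype F] [Algebra (ZMod p) F]
  {α : Fˣ} {n : ℕ}

/-- Multiplication by `z` permutes the three cosets of cubes; the proof compares two sums over the
field instead. -/
theorem sum_range_mul_generator (hα : ∀ x : Fˣ, x ∈ Subgroup.zpowers α)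
    (hq : Fintype.card F = n * 3 + 1) (f : F → ℤ)
    (hf : ∀ (x : F) (u : Fˣ), f (x * (u : F) ^ 3) = f x) {z : F} (hz : z ≠ 0) :
    ∑ i ∈ range 3, f (z * ((α ^ i : Fˣ) : F)) = ∑ i ∈ range 3, f ((α ^ i : Fˣ) : F) := by
  have hn : (n : ℤ) ≠ 0 := by exact_mod_cast (pos_of_card_eq hq).ne'
  have h1 := sum_of_mul_cube_invariant hα hq f hf
  have h2 := sum_of_mul_cube_invariant hα hq (fun x => f (z * x))
    (fun x u => by rw [← mul_assoc, hf])
  have h3 : ∑ x, f (z * x) = ∑ x, f x := Equiv.sum_comp (Equiv.mulLeft₀ z hz) f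
  rw [h3, h1, mul_zero, add_right_inj, nsmul_eq_mul, nsmul_eq_mul] at h2
  exact (mul_left_cancel₀ hn h2).symm

theorem card_definingSet (hα : ∀ x : Fˣ, x ∈ Subgroup.zpowers α)
    (hq : Fintype.card F = n * 3 + 1) {I : Finset (Fin 3)} (hI : #I = 2) :
    Nat.card (definingSet α 3 I) = 2 * n := by
  classical
  have h := three_mul_ncard_definingSet hα hq I (fun _ => True)
  have h2 : #{y : F | y ≠ 0} = n * 3 := by
    rw [Finset.filter_ne', Finset.card_erase_of_mem (mem_univ _), card_univ, hq,
      Nat.add_sub_cancel]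
  simp only [and_true, h2, Finset.sum_const, hI, smul_eq_mul] at h
  rw [← Set.ncard_univ]
  have h3 : {d : definingSet α 3 I | True} = Set.univ := by ext; simp
  rw [h3] at h
  omega

/-- The number of coordinates equal to a nonzero `ρ` in a codeword. -/
theorem ncard_coord_eq (hα : ∀ x : Fˣ, x ∈ Subgroup.zpowers α)
    (hq : Fintype.card F = n * 3 + 1)
    (hc : ∀ u : ZMod p, u ≠ 0 → ∃ v : Fˣ, algebraMap (ZMod p) F u = (v : F) ^ 3)
    (k : Fin 3) {x : F} (hx : x ≠ 0) {ρ : ZMod p} (hρ : ρ ≠ 0) :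
    (3 * p * {d | traceEncoder p (definingSet α 3 (univ.erase k)) x d = ρ}.ncard : ℤ)
      = 2 * Fintype.card F + cubicPeriod p (x * ((α ^ (k : ℕ) : Fˣ) : F)) := by
  classical
  have h := three_mul_ncard_definingSet hα hq (univ.erase k)
    (fun d => Algebra.trace (ZMod p) F (x * d) = ρ)
  have h1 : ∀ i : Fin 3, #{y : F | y ≠ 0 ∧
      Algebra.trace (ZMod p) F (x * (((α ^ (i : ℕ) : Fˣ) : F) * y ^ 3)) = ρ}
      = cubicTraceCount p (x * ((α ^ (i : ℕ) : Fˣ) : F)) 1 := by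
    intro i
    rw [← cubicTraceCount_eq_one p hc _ hρ, cubicTraceCount]
    congr 1
    ext y
    simp only [mem_filter, mem_univ, true_and, ← mul_assoc, and_iff_right_iff_imp]
    rintro h rfl
    simp at h
    exact hρ h.symm
  simp only [h1] at h
  -- The periods sum to zero, so the two classes in `D` together contribute minus the period of the
  -- missing class.
  have h2 := sum_range_mul_generator hα hq (cubicPeriod p) (cubicPeriod_mul_cube p) hx
  rw [sum_cubicPeriod_generator p hα hq hc,
    Finset.sum_range (fun i => cubicPeriod p (x * ((α ^ i : Fˣ) : F))),
    ← Finset.add_sum_erase _ _ (mem_univ k)] at h2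
  have h3 : (3 * {d | traceEncoder p (definingSet α 3 (univ.erase k)) x d = ρ}.ncard : ℤ)
      = ∑ i ∈ univ.erase k, (cubicTraceCount p (x * ((α ^ (i : ℕ) : Fˣ) : F)) 1 : ℤ) := by
    exact_mod_cast h
  have h4 : ∑ i ∈ univ.erase k, cubicPeriod p (x * ((α ^ (i : ℕ) : Fˣ) : F))
      = 2 * Fintype.card F - p * (3 *
        {d | traceEncoder p (definingSet α 3 (univ.erase k)) x d = ρ}.ncard) := by
    rw [h3]
    simp only [cubicPeriod_eq p hc, Finset.sum_sub_distrib, ← Finset.mul_sum, Finset.sum_const,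
      Finset.card_erase_of_mem (mem_univ k)]
    simp
  linarith

theorem cubicPeriod_sq_le (hα : ∀ x : Fˣ, x ∈ Subgroup.zpowers α)
    (hq : Fintype.card F = n * 3 + 1)
    (hc : ∀ u : ZMod p, u ≠ 0 → ∃ v : Fˣ, algebraMap (ZMod p) F u = (v : F) ^ 3)
    {z : F} (hz : z ≠ 0) : cubicPeriod p z ^ 2 ≤ 6 * Fintype.card F := by
  have h := sum_range_mul_generator hα hq (fun x => cubicPeriod p x ^ 2)
    (fun x u => by simp only [cubicPeriod_mul_cube]) hz
  simp only [sum_cubicPeriod_generator_sq p hα hq hc] at h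
  rw [hq, ← h]
  have := Finset.single_le_sum (f := fun i => cubicPeriod p (z * ((α ^ i : Fˣ) : F)) ^ 2)
    (fun i _ => sq_nonneg _) (mem_range.2 (show 0 < 3 by norm_num))
  simpa using this

/-- A nonzero `x` with zero word would have a period equal to `-2r`, and then `4r² ≤ 6r`, impossible
for `r ≥ 4`. -/
theorem traceEncoder_injective (hα : ∀ x : Fˣ, x ∈ Subgroup.zpowers α)
    (hq : Fintype.card F = n * 3 + 1)
    (hc : ∀ u : ZMod p, u ≠ 0 → ∃ v : Fˣ, algebraMap (ZMod p) F u = (v : F) ^ 3)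
    (k : Fin 3) : Function.Injective (traceEncoder p (definingSet α 3 (univ.erase k))) := by
  rw [injective_iff_map_eq_zero]
  intro x hx
  by_contra hx0
  have h := ncard_coord_eq p hα hq hc k hx0 (one_ne_zero (α := ZMod p))
  have h0 : {d | traceEncoder p (definingSet α 3 (univ.erase k)) x d = 1} = ∅ := by
    ext d
    simp [hx]
  rw [h0, Set.ncard_empty, Nat.cast_zero, mul_zero] at h
  have h2 := cubicPeriod_sq_le p hα hq hc (mul_ne_zero hx0 (α ^ (k : ℕ)).ne_zero)
  have hn := pos_of_card_eq hq
  rw [eq_neg_of_add_eq_zero_right h.symm] at h2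
  have h4 : (4 : ℤ) ≤ Fintype.card F := by omega
  nlinarith

theorem isLinearCode_traceCode (hα : ∀ x : Fˣ, x ∈ Subgroup.zpowers α)
    (hq : Fintype.card F = n * 3 + 1)
    (hc : ∀ u : ZMod p, u ≠ 0 → ∃ v : Fˣ, algebraMap (ZMod p) F u = (v : F) ^ 3)
    (k : Fin 3) {m : ℕ} (hm : Fintype.card F = p ^ m) :
    IsLinearCode (traceCode p (definingSet α 3 (univ.erase k))) (2 * n) m := by
  refine ⟨card_definingSet hα hq (by simp [Finset.card_erase_of_mem]), ?_⟩
  rw [← range_traceEncoder, LinearMap.finrank_range_of_inj (traceEncoder_injective p hα hq hc k)]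
  have h := Module.card_eq_pow_finrank (K := ZMod p) (V := F)
  rw [ZMod.card, hm] at h
  exact (Nat.pow_right_injective (Fact.out : p.Prime).two_le h).symm

/-- The number of coordinates equal to a given nonzero element in a codeword of period `e`, in the
code of `F` with `r` elements. -/
def coordCount (p r : ℕ) (e : ℤ) : ℕ := ((2 * r + e) / (3 * p)).toNat

/-- The contribution to the enumerator of a codeword of period `e`. -/
noncomputable def periodMonomial (n r : ℕ) (e : ℤ) : MvPolynomial (ZMod p) ℤ :=
  weightMonomial p (2 * n - (p - 1) * coordCount p r e) (coordCount p r e)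

/-- Twisting by `α^(-k)` makes the period of the missing class that of `z`, so the choice of `I`
drops out. -/
theorem coordCount_spec_and_wordEnumerator (hα : ∀ x : Fˣ, x ∈ Subgroup.zpowers α)
    (hq : Fintype.card F = n * 3 + 1)
    (hc : ∀ u : ZMod p, u ≠ 0 → ∃ v : Fˣ, algebraMap (ZMod p) F u = (v : F) ^ 3)
    (k : Fin 3) {z : F} (hz : z ≠ 0) :
    (3 * p * coordCount p (Fintype.card F) (cubicPeriod p z) : ℤ)
        = 2 * Fintype.card F + cubicPeriod p z ∧
      (p - 1) * coordCount p (Fintype.card F) (cubicPeriod p z) ≤ 2 * n ∧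
      wordEnumerator (traceEncoder p (definingSet α 3 (univ.erase k))
          (z * ((α ^ (k : ℕ))⁻¹ : Fˣ)))
        = periodMonomial p n (Fintype.card F) (cubicPeriod p z) := by
  have hx : z * (((α ^ (k : ℕ))⁻¹ : Fˣ) : F) ≠ 0 := mul_ne_zero hz (Units.ne_zero _)
  have hp : (3 * p : ℤ) ≠ 0 := by
    have := (Fact.out : p.Prime).ne_zero
    positivity
  have key : ∀ ρ : ZMod p, ρ ≠ 0 →
      {d | traceEncoder p (definingSet α 3 (univ.erase k))
        (z * (((α ^ (k : ℕ))⁻¹ : Fˣ) : F)) d = ρ}.ncard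
        = coordCount p (Fintype.card F) (cubicPeriod p z) := by
    intro ρ hρ
    have h := ncard_coord_eq p hα hq hc k hx hρ
    rw [Units.inv_mul_cancel_right] at h
    rw [coordCount, ← h, Int.mul_ediv_cancel_left _ hp, Int.toNat_natCast]
  have h1 := ncard_coord_eq p hα hq hc k hx (one_ne_zero (α := ZMod p))
  rw [key 1 one_ne_zero, Units.inv_mul_cancel_right] at h1
  have h2 := wordEnumerator_eq_weightMonomial p _ key
  rw [card_definingSet hα hq (by simp [Finset.card_erase_of_mem])] at h2
  exact ⟨h1, h2.1, h2.2⟩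

/-- The count formula makes `2r + η` divisible by 3, and `r ≡ 1 (mod 3)`. -/
theorem cubicPeriod_modEq_one (hα : ∀ x : Fˣ, x ∈ Subgroup.zpowers α)
    (hq : Fintype.card F = n * 3 + 1)
    (hc : ∀ u : ZMod p, u ≠ 0 → ∃ v : Fˣ, algebraMap (ZMod p) F u = (v : F) ^ 3)
    {z : F} (hz : z ≠ 0) : cubicPeriod p z ≡ 1 [ZMOD 3] := by
  have h := (coordCount_spec_and_wordEnumerator p hα hq hc 0 hz).1
  rw [mul_assoc] at h
  unfold Int.ModEq
  omega

theorem CWE_eq_sum_periodMonomial (hα : ∀ x : Fˣ, x ∈ Subgroup.zpowers α)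
    (hq : Fintype.card F = n * 3 + 1)
    (hc : ∀ u : ZMod p, u ≠ 0 → ∃ v : Fˣ, algebraMap (ZMod p) F u = (v : F) ^ 3)
    (k : Fin 3) :
    CWE (traceCode p (definingSet α 3 (univ.erase k))) = MvPolynomial.X 0 ^ (2 * n)
      + (n : MvPolynomial (ZMod p) ℤ) * ∑ i ∈ range 3, periodMonomial p n (Fintype.card F)
        (cubicPeriod p ((α ^ i : Fˣ) : F)) := by
  classical
  rw [CWE_traceCode p _ (traceEncoder_injective p hα hq hc k),
    ← Equiv.sum_comp (Equiv.mulRight₀ (((α ^ (k : ℕ))⁻¹ : Fˣ) : F) (Units.ne_zero _))]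
  have h : ∀ z : F, wordEnumerator (traceEncoder p (definingSet α 3 (univ.erase k))
      (Equiv.mulRight₀ (((α ^ (k : ℕ))⁻¹ : Fˣ) : F) (Units.ne_zero _) z))
      = if z = 0 then MvPolynomial.X 0 ^ (2 * n)
        else periodMonomial p n (Fintype.card F) (cubicPeriod p z) := by
    intro z
    split_ifs with hz
    · simp only [hz, Equiv.mulRight₀_apply, zero_mul, map_zero]
      rw [wordEnumerator_zero, card_definingSet hα hq (by simp [Finset.card_erase_of_mem])]
    · exact (coordCount_spec_and_wordEnumerator p hα hq hc k hz).2.2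
  rw [Finset.sum_congr rfl fun z _ => h z, sum_of_mul_cube_invariant hα hq _ (fun x u => by
    simp only [mul_eq_zero, pow_eq_zero_iff (three_ne_zero), Units.ne_zero, or_false,
      cubicPeriod_mul_cube])]
  simp only [if_true, Units.ne_zero, if_false, nsmul_eq_mul]

end Weights

/-! ### Values of the periods and of the exponents. -/

section Evaluation

theorem rpow_one_third (p k : ℕ) : ((p ^ (3 * k) : ℕ) : ℝ) ^ (1 / 3 : ℝ) = (p : ℝ) ^ k := by
  rw [mul_comm, pow_mul]
  push_cast
  rw [← Real.rpow_natCast _ 3, ← Real.rpow_mul (by positivity)]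
  norm_num

theorem sqrt_pow_two_mul (p l : ℕ) : √((p ^ (2 * l) : ℕ) : ℝ) = (p : ℝ) ^ l := by
  rw [mul_comm, pow_mul]
  push_cast
  exact Real.sqrt_sq (by positivity)

variable (p : ℕ) [Fact p.Prime] {F : Type*} [Field F] [Fintype F] [Algebra (ZMod p) F]
  {α : Fˣ} {n : ℕ}

/-- The three periods, as a multiset. -/
noncomputable def periodMultiset (α : Fˣ) : Multiset ℤ :=
  {cubicPeriod p ((α ^ 0 : Fˣ) : F), cubicPeriod p ((α ^ 1 : Fˣ) : F),
    cubicPeriod p ((α ^ 2 : Fˣ) : F)}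

/-- The enumerator is symmetric in the periods, so their order need not be determined. -/
theorem CWE_eq_of_periodMultiset_eq (hα : ∀ x : Fˣ, x ∈ Subgroup.zpowers α)
    (hq : Fintype.card F = n * 3 + 1)
    (hc : ∀ u : ZMod p, u ≠ 0 → ∃ v : Fˣ, algebraMap (ZMod p) F u = (v : F) ^ 3)
    (k : Fin 3) {a b c : ℤ} (h : periodMultiset p α = {a, b, c}) :
    CWE (traceCode p (definingSet α 3 (univ.erase k))) = MvPolynomial.X 0 ^ (2 * n)
      + (n : MvPolynomial (ZMod p) ℤ) * periodMonomial p n (Fintype.card F) a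
      + (n : MvPolynomial (ZMod p) ℤ) * periodMonomial p n (Fintype.card F) b
      + (n : MvPolynomial (ZMod p) ℤ) * periodMonomial p n (Fintype.card F) c := by
  have h1 := congrArg (fun s => (s.map (periodMonomial p n (Fintype.card F))).sum) h
  simp only [periodMultiset, Multiset.insert_eq_cons, Multiset.map_cons, Multiset.map_singleton,
    Multiset.sum_cons, Multiset.sum_singleton] at h1
  rw [CWE_eq_sum_periodMonomial p hα hq hc k]
  simp only [Finset.sum_range_succ, Finset.sum_range_zero, zero_add]
  rw [add_assoc (periodMonomial _ _ _ _), h1]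
  ring

/-- The real values of the exponents attached to a period. -/
theorem exponents_eq (hα : ∀ x : Fˣ, x ∈ Subgroup.zpowers α)
    (hq : Fintype.card F = n * 3 + 1)
    (hc : ∀ u : ZMod p, u ≠ 0 → ∃ v : Fˣ, algebraMap (ZMod p) F u = (v : F) ^ 3)
    {e : ℤ} (he : e ∈ periodMultiset p α) :
    ((2 * n - (p - 1) * coordCount p (Fintype.card F) e : ℕ) : ℝ)
        = 2 * n / p - (p - 1) / (3 * p) * (2 + e) ∧
      (coordCount p (Fintype.card F) e : ℝ) = 2 * n / p + 1 / (3 * p) * (2 + e) := by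
  obtain ⟨z, hz, rfl⟩ : ∃ z : F, z ≠ 0 ∧ e = cubicPeriod p z := by
    simp only [periodMultiset, Multiset.insert_eq_cons, Multiset.mem_cons,
      Multiset.mem_singleton] at he
    rcases he with rfl | rfl | rfl <;> exact ⟨_, Units.ne_zero _, rfl⟩
  obtain ⟨h1, h2, -⟩ := coordCount_spec_and_wordEnumerator p hα hq hc 0 hz
  have hp : (p : ℝ) ≠ 0 := by exact_mod_cast (Fact.out : p.Prime).ne_zero
  have h3 : (coordCount p (Fintype.card F) (cubicPeriod p z) : ℝ)
      = 2 * n / p + 1 / (3 * p) * (2 + cubicPeriod p z) := by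
    rw [hq] at h1 ⊢
    have h1 : ((3 * p * coordCount p (n * 3 + 1) (cubicPeriod p z) : ℤ) : ℝ)
      = ((2 * (n * 3 + 1 : ℕ) + cubicPeriod p z : ℤ) : ℝ) := by rw [h1]
    push_cast at h1
    field_simp
    linarith
  refine ⟨?_, h3⟩
  rw [Nat.cast_sub h2, Nat.cast_mul (p - 1), h3, Nat.cast_sub (Fact.out : p.Prime).one_le]
  push_cast
  field_simp
  ring

theorem periodMultiset_eq_of_two_mod_three (hα : ∀ x : Fˣ, x ∈ Subgroup.zpowers α)
    (hq : Fintype.card F = n * 3 + 1)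
    (hc : ∀ u : ZMod p, u ≠ 0 → ∃ v : Fˣ, algebraMap (ZMod p) F u = (v : F) ^ 3)
    (hp : p ≡ 2 [MOD 3]) {l : ℕ} (hl : Fintype.card F = p ^ (2 * l)) :
    periodMultiset p α
      = {(-1) ^ l * (p : ℤ) ^ l, (-1) ^ l * (p : ℤ) ^ l, -(2 * ((-1) ^ l * (p : ℤ) ^ l))} := by
  have h1 := sum_cubicPeriod_generator p hα hq hc
  have h2 := sum_cubicPeriod_generator_sq p hα hq hc
  rw [← hq, hl] at h2
  push_cast at h2
  simp only [Finset.sum_range_succ, Finset.sum_range_zero, zero_add] at h1 h2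
  exact multiset_eq_of_two_mod_three (Fact.out : p.Prime) hp h1 h2
    (cubicPeriod_modEq_one p hα hq hc (Units.ne_zero _))
    (cubicPeriod_modEq_one p hα hq hc (Units.ne_zero _))

theorem exists_periodMultiset_eq_of_one_mod_three (hα : ∀ x : Fˣ, x ∈ Subgroup.zpowers α)
    (hq : Fintype.card F = n * 3 + 1)
    (hc : ∀ u : ZMod p, u ≠ 0 → ∃ v : Fˣ, algebraMap (ZMod p) F u = (v : F) ^ 3)
    (hp : p ≡ 1 [MOD 3]) {k : ℕ} (hk : Fintype.card F = p ^ (3 * k)) :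
    ∃ s t v w : ℤ, 4 * (p : ℤ) ^ k = s ^ 2 + 27 * t ^ 2 ∧ s ≡ 1 [ZMOD 3] ∧ ¬ (p : ℤ) ∣ s ∧
      2 * v = -(s - 9 * t) ∧ 2 * w = -(s + 9 * t) ∧
      periodMultiset p α = {(p : ℤ) ^ k * v, (p : ℤ) ^ k * s, (p : ℤ) ^ k * w} := by
  classical
  have hpr := (Fact.out : p.Prime)
  have hp2 : p ≠ 2 := by rintro rfl; revert hp; decide
  have hp1 : (p : ℤ) ≡ 1 [ZMOD 3] := Int.natCast_modEq_iff.2 hp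
  have hk0 : k ≠ 0 := by
    rintro rfl
    have := Fintype.one_lt_card (α := F)
    simp at hk
    omega
  have hqp : (n * 3 + 1 : ℕ) = p ^ (3 * k) := hq.symm.trans hk
  have hqz : (n * 3 + 1 : ℤ) = (p : ℤ) ^ (3 * k) := by exact_mod_cast hqp
  have hpq : (p : ℤ) ∣ (p : ℤ) ^ (3 * k) := dvd_pow_self _ (by omega)
  have hpn : ¬ (p : ℤ) ∣ 3 * n := by
    intro h
    have h1 : (p : ℤ) ∣ 1 := by
      have := dvd_sub hpq h
      rwa [show (p : ℤ) ^ (3 * k) - 3 * n = 1 by rw [← hqz]; ring] at this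
    exact hpr.one_lt.ne' (by exact_mod_cast Int.eq_one_of_dvd_one (by positivity) h1)
  have h1 := sum_cubicPeriod_generator p hα hq hc
  have h2 := sum_cubicPeriod_generator_sq p hα hq hc
  have h3 := prod_cubicPeriod_generator p hα hq hc
  have hN := not_dvd_card_sum_three_cubes_eq_zero p hp hqp hq
  set N := #{v : Fin 3 → F | ∑ i, v i ^ 3 = 0}
  rw [hqp, show 3 * k = 2 * k + k by ring] at h2
  push_cast at h2 h3
  simp only [Finset.sum_range_succ, Finset.sum_range_zero, zero_add] at h1 h2
  rw [hqz] at h3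
  -- With `p ∤ 3n`, this makes the valuation of the product of the periods exactly `3k`.
  have hN' : ¬ (p : ℤ) ∣ N - ((p : ℤ) ^ (3 * k)) ^ 2 := by
    intro h
    apply hN
    have := dvd_add h (hpq.trans (dvd_pow_self _ two_ne_zero))
    rw [sub_add_cancel] at this
    exact_mod_cast this
  have hm0 := cubicPeriod_modEq_one p hα hq hc (α ^ 0).ne_zero
  have hm1 := cubicPeriod_modEq_one p hα hq hc (α ^ 1).ne_zero
  unfold periodMultiset
  obtain ⟨a, b, c, ha, hb, hc', hs, hs2, hpa, hpb, hpc⟩ :=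
    exists_eq_pow_mul_of_prod_valuation hpr hp2 k k _ _ _ (3 * n)
      (N - ((p : ℤ) ^ (3 * k)) ^ 2) h1 (by exact_mod_cast h2)
      (by simp only [Units.val_pow_eq_pow_val]; linear_combination h3) hpn hN'
  rw [ha] at hm0
  rw [hb] at hm1
  have hpk : (p : ℤ) ^ k ≡ 1 [ZMOD 3] := by simpa using hp1.pow k
  have key : ∀ a : ℤ, (p : ℤ) ^ k * a ≡ 1 [ZMOD 3] → a ≡ 1 [ZMOD 3] := fun a h => by
    have := hpk.mul_right a
    rw [one_mul] at this
    exact this.symm.trans h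
  obtain ⟨s, t, v, w, h4, hs1, hps, hv, hw, hmul⟩ :=
    exists_cubic_pair hp1 hs hs2 (key a hm0) (key b hm1) hpa hpb hpc
  refine ⟨s, t, v, w, h4, hs1, hps, hv, hw, ?_⟩
  have hmul := congrArg (Multiset.map fun t => (p : ℤ) ^ k * t) hmul
  simp only [Multiset.insert_eq_cons, Multiset.map_cons, Multiset.map_singleton] at hmul ⊢
  rw [ha, hb, hc', hmul]

theorem isCubicPair_iff {k : ℕ} (s t : ℤ) :
    IsCubicPair p (p ^ (3 * k)) s t ↔
      4 * (p : ℤ) ^ k = s ^ 2 + 27 * t ^ 2 ∧ s ≡ 1 [ZMOD 3] ∧ ¬ (p : ℤ) ∣ s := by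
  have h1 := rpow_one_third p k
  have h2 : Int.gcd s p = 1 ↔ ¬ (p : ℤ) ∣ s := by
    rw [← Int.isCoprime_iff_gcd_eq_one, isCoprime_comm,
      Prime.coprime_iff_not_dvd (Nat.prime_iff_prime_int.1 (Fact.out : p.Prime))]
  rw [IsCubicPair, h1, h2]
  refine and_congr_left fun _ => ?_
  exact_mod_cast Iff.rfl

/-- By uniqueness any admissible pair differs from the constructed one at most in the sign of `t`,
which only swaps `v` and `w`. -/
theorem periodMultiset_eq_of_isCubicPair (hα : ∀ x : Fˣ, x ∈ Subgroup.zpowers α)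
    (hq : Fintype.card F = n * 3 + 1)
    (hc : ∀ u : ZMod p, u ≠ 0 → ∃ v : Fˣ, algebraMap (ZMod p) F u = (v : F) ^ 3)
    (hp : p ≡ 1 [MOD 3]) {k : ℕ} (hk : Fintype.card F = p ^ (3 * k)) {s t : ℤ}
    (hst : IsCubicPair p (p ^ (3 * k)) s t) :
    ∃ v w : ℤ, 2 * v = -(s - 9 * t) ∧ 2 * w = -(s + 9 * t) ∧
      periodMultiset p α = {(p : ℤ) ^ k * v, (p : ℤ) ^ k * s, (p : ℤ) ^ k * w} := by
  have hp2 : p ≠ 2 := by rintro rfl; revert hp; decide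
  have hk0 : k ≠ 0 := by
    rintro rfl
    have := Fintype.one_lt_card (α := F)
    simp at hk
    omega
  obtain ⟨s', t', v, w, h4, hs1, hps, hv, hw, hmul⟩ :=
    exists_periodMultiset_eq_of_one_mod_three p hα hq hc hp hk
  obtain ⟨h4', hs1', hps'⟩ := (isCubicPair_iff p s t).1 hst
  obtain ⟨rfl, rfl | rfl⟩ :=
    cubic_pair_unique (Fact.out : p.Prime) hp2 hk0 h4' h4 hs1' hs1 hps' hps
  · exact ⟨v, w, hv, hw, hmul⟩
  · refine ⟨w, v, by rw [hw]; ring, by rw [hv]; ring, ?_⟩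
    rw [hmul, multiset_cons_rotate, multiset_cons_rotate, multiset_cons_swap_right]

end Evaluation

end CyclotomicCode

/-! ### The complete weight enumerator. -/

theorem mainTheorem2 (p m r n : ℕ) [Fact p.Prime] (hm : 0 < m) (hr : r = p ^ m)
    (F : Type*) [Field F] [Finite F] [Algebra (ZMod p) F] (hF : Nat.card F = r)
    (α : Fˣ) (hα : ∀ x : Fˣ, x ∈ Subgroup.zpowers α)
    (hN : 3 ∣ (r - 1) / (p - 1)) (hn : r - 1 = n * 3)
    (I : Finset (Fin 3)) (hI : I.card = 2) :
    CyclotomicCode.IsLinearCode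
        (CyclotomicCode.traceCode p (CyclotomicCode.definingSet α 3 I)) (2 * n) m ∧
    (p ≡ 1 [MOD 3] → m ≡ 0 [MOD 3] →
      (∃ s t : ℤ, CyclotomicCode.IsCubicPair p r s t) ∧
      ∀ s t : ℤ, CyclotomicCode.IsCubicPair p r s t →
        ∃ a₁ b₁ a₂ b₂ a₃ b₃ : ℕ,
          (a₁ : ℝ) = 2 * n / p
            - (p - 1) / (6 * p) * (4 - (s - 9 * t) * (r : ℝ) ^ (1 / 3 : ℝ)) ∧
          (b₁ : ℝ) = 2 * n / p
            + 1 / (6 * p) * (4 - (s - 9 * t) * (r : ℝ) ^ (1 / 3 : ℝ)) ∧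
          (a₂ : ℝ) = 2 * n / p - (p - 1) / (3 * p) * (2 + s * (r : ℝ) ^ (1 / 3 : ℝ)) ∧
          (b₂ : ℝ) = 2 * n / p + 1 / (3 * p) * (2 + s * (r : ℝ) ^ (1 / 3 : ℝ)) ∧
          (a₃ : ℝ) = 2 * n / p
            - (p - 1) / (6 * p) * (4 - (s + 9 * t) * (r : ℝ) ^ (1 / 3 : ℝ)) ∧
          (b₃ : ℝ) = 2 * n / p
            + 1 / (6 * p) * (4 - (s + 9 * t) * (r : ℝ) ^ (1 / 3 : ℝ)) ∧
          CyclotomicCode.CWE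
              (CyclotomicCode.traceCode p (CyclotomicCode.definingSet α 3 I)) =
            MvPolynomial.X 0 ^ (2 * n)
              + (n : MvPolynomial (ZMod p) ℤ) * CyclotomicCode.weightMonomial p a₁ b₁
              + (n : MvPolynomial (ZMod p) ℤ) * CyclotomicCode.weightMonomial p a₂ b₂
              + (n : MvPolynomial (ZMod p) ℤ) * CyclotomicCode.weightMonomial p a₃ b₃) ∧
    (p ≡ 2 [MOD 3] → m ≡ 0 [MOD 4] →
      ∃ a₁ b₁ a₂ b₂ : ℕ,
        (a₁ : ℝ) = 2 * n / p - (p - 1) / (3 * p) * (2 + Real.sqrt r) ∧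
        (b₁ : ℝ) = 2 * n / p + 1 / (3 * p) * (2 + Real.sqrt r) ∧
        (a₂ : ℝ) = 2 * n / p - 2 * (p - 1) / (3 * p) * (1 - Real.sqrt r) ∧
        (b₂ : ℝ) = 2 * n / p + 2 / (3 * p) * (1 - Real.sqrt r) ∧
        CyclotomicCode.CWE
            (CyclotomicCode.traceCode p (CyclotomicCode.definingSet α 3 I)) =
          MvPolynomial.X 0 ^ (2 * n)
            + ((2 * n : ℕ) : MvPolynomial (ZMod p) ℤ) * CyclotomicCode.weightMonomial p a₁ b₁
            + (n : MvPolynomial (ZMod p) ℤ) * CyclotomicCode.weightMonomial p a₂ b₂) ∧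
    (p ≡ 2 [MOD 3] → m ≡ 2 [MOD 4] →
      ∃ a₁ b₁ a₂ b₂ : ℕ,
        (a₁ : ℝ) = 2 * n / p - (p - 1) / (3 * p) * (2 - Real.sqrt r) ∧
        (b₁ : ℝ) = 2 * n / p + 1 / (3 * p) * (2 - Real.sqrt r) ∧
        (a₂ : ℝ) = 2 * n / p - 2 * (p - 1) / (3 * p) * (1 + Real.sqrt r) ∧
        (b₂ : ℝ) = 2 * n / p + 2 / (3 * p) * (1 + Real.sqrt r) ∧
        CyclotomicCode.CWE
            (CyclotomicCode.traceCode p (CyclotomicCode.definingSet α 3 I)) =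
          MvPolynomial.X 0 ^ (2 * n)
            + ((2 * n : ℕ) : MvPolynomial (ZMod p) ℤ) * CyclotomicCode.weightMonomial p a₁ b₁
            + (n : MvPolynomial (ZMod p) ℤ) * CyclotomicCode.weightMonomial p a₂ b₂) := by
  classical
  subst hr
  have := Fintype.ofFinite F
  have hp := (Fact.out : p.Prime)
  have hr0 : 0 < p ^ m := pow_pos hp.pos m
  have hF' : Fintype.card F = p ^ m := by rw [← Nat.card_eq_fintype_card, hF]
  have hq : Fintype.card F = n * 3 + 1 := by omega
  have hpR : (p : ℝ) ≠ 0 := by exact_mod_cast hp.ne_zero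
  have hdvd : p - 1 ∣ p ^ m - 1 := by simpa using Nat.sub_dvd_pow_sub_pow p 1 m
  have hc : ∀ u : ZMod p, u ≠ 0 → ∃ v : Fˣ, algebraMap (ZMod p) F u = (v : F) ^ 3 :=
    CyclotomicCode.algebraMap_eq_cube hα (by rwa [hF']) (by rwa [hF'])
  obtain ⟨k, rfl⟩ : ∃ k, I = Finset.univ.erase k := by
    obtain ⟨k, hk⟩ := Finset.card_eq_one.1 (show Iᶜ.card = 1 by
      rw [Finset.card_compl, hI, Fintype.card_fin])
    exact ⟨k, by rw [← Finset.compl_singleton, ← hk, compl_compl]⟩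
  refine ⟨CyclotomicCode.isLinearCode_traceCode p hα hq hc k hF', fun h1 h3 => ?_,
    fun h2 h4 => ?_, fun h2 h4 => ?_⟩
  · obtain ⟨l, rfl⟩ : 3 ∣ m := (Nat.modEq_zero_iff_dvd).1 h3
    refine ⟨?_, fun s t hst => ?_⟩
    · obtain ⟨s, t, v, w, h4, hs1, hps, -⟩ :=
        CyclotomicCode.exists_periodMultiset_eq_of_one_mod_three p hα hq hc h1 hF'
      exact ⟨s, t, (CyclotomicCode.isCubicPair_iff p s t).2 ⟨h4, hs1, hps⟩⟩
    · obtain ⟨v, w, hv, hw, hmul⟩ :=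
        CyclotomicCode.periodMultiset_eq_of_isCubicPair p hα hq hc h1 hF' hst
      have hroot : ((p ^ (3 * l) : ℕ) : ℝ) ^ (1 / 3 : ℝ) = (p : ℝ) ^ l :=
        CyclotomicCode.rpow_one_third p l
      have hv' : (2 * v : ℝ) = -(s - 9 * t) := by exact_mod_cast hv
      have hw' : (2 * w : ℝ) = -(s + 9 * t) := by exact_mod_cast hw
      have ev := CyclotomicCode.exponents_eq p hα hq hc (e := (p : ℤ) ^ l * v) (by simp [hmul])
      have es := CyclotomicCode.exponents_eq p hα hq hc (e := (p : ℤ) ^ l * s) (by simp [hmul])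
      have ew := CyclotomicCode.exponents_eq p hα hq hc (e := (p : ℤ) ^ l * w) (by simp [hmul])
      simp only [Int.cast_mul, Int.cast_pow, Int.cast_natCast] at ev es ew
      refine ⟨_, _, _, _, _, _, ev.1.trans ?_, ev.2.trans ?_, es.1.trans ?_, es.2.trans ?_,
        ew.1.trans ?_, ew.2.trans ?_,
        CyclotomicCode.CWE_eq_of_periodMultiset_eq p hα hq hc k hmul⟩
      all_goals rw [hroot]
      · rw [show (v : ℝ) = -(s - 9 * t) / 2 by linarith]
        field_simp
        ring
      · rw [show (v : ℝ) = -(s - 9 * t) / 2 by linarith]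
        field_simp
        ring
      · ring
      · ring
      · rw [show (w : ℝ) = -(s + 9 * t) / 2 by linarith]
        field_simp
        ring
      · rw [show (w : ℝ) = -(s + 9 * t) / 2 by linarith]
        field_simp
        ring
  · obtain ⟨j, rfl⟩ : 4 ∣ m := (Nat.modEq_zero_iff_dvd).1 h4
    -- Here `√r = p^(2j)`, an even power of `p`, so the periods are `√r, √r, -2√r`.
    have hl : 4 * j = 2 * (2 * j) := by ring
    rw [hl] at hF' ⊢
    have hmul := CyclotomicCode.periodMultiset_eq_of_two_mod_three p hα hq hc h2 hF'
    rw [pow_mul (-1 : ℤ), neg_one_sq, one_pow, one_mul] at hmul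
    have e1 := CyclotomicCode.exponents_eq p hα hq hc (e := (p : ℤ) ^ (2 * j)) (by simp [hmul])
    have e2 := CyclotomicCode.exponents_eq p hα hq hc (e := -(2 * (p : ℤ) ^ (2 * j)))
      (by simp [hmul])
    simp only [Int.cast_neg, Int.cast_mul, Int.cast_pow, Int.cast_natCast, Int.cast_ofNat]
      at e1 e2
    refine ⟨_, _, _, _, e1.1.trans ?_, e1.2.trans ?_, e2.1.trans ?_, e2.2.trans ?_, ?_⟩
    · rw [CyclotomicCode.sqrt_pow_two_mul]
    · rw [CyclotomicCode.sqrt_pow_two_mul]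
    · rw [CyclotomicCode.sqrt_pow_two_mul]
      ring
    · rw [CyclotomicCode.sqrt_pow_two_mul]
      ring
    · rw [CyclotomicCode.CWE_eq_of_periodMultiset_eq p hα hq hc k hmul]
      unfold CyclotomicCode.periodMonomial
      push_cast
      ring
  · obtain ⟨j, rfl⟩ : ∃ j, m = 4 * j + 2 := ⟨m / 4, by unfold Nat.ModEq at h4; omega⟩
    -- Now `√r` is an odd power of `p`, and all three signs flip.
    have hl : 4 * j + 2 = 2 * (2 * j + 1) := by ring
    rw [hl] at hF' ⊢
    have hmul := CyclotomicCode.periodMultiset_eq_of_two_mod_three p hα hq hc h2 hF'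
    rw [pow_succ (-1 : ℤ), pow_mul (-1 : ℤ), neg_one_sq, one_pow, one_mul, neg_one_mul] at hmul
    have e1 := CyclotomicCode.exponents_eq p hα hq hc (e := -(p : ℤ) ^ (2 * j + 1))
      (by simp [hmul])
    have e2 := CyclotomicCode.exponents_eq p hα hq hc (e := -(2 * -(p : ℤ) ^ (2 * j + 1)))
      (by simp [hmul])
    simp only [Int.cast_neg, Int.cast_mul, Int.cast_pow, Int.cast_natCast, Int.cast_ofNat]
      at e1 e2
    refine ⟨_, _, _, _, e1.1.trans ?_, e1.2.trans ?_, e2.1.trans ?_, e2.2.trans ?_, ?_⟩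
    · rw [CyclotomicCode.sqrt_pow_two_mul]
      ring
    · rw [CyclotomicCode.sqrt_pow_two_mul]
      ring
    · rw [CyclotomicCode.sqrt_pow_two_mul]
      ring
    · rw [CyclotomicCode.sqrt_pow_two_mul]
      ring
    · rw [CyclotomicCode.CWE_eq_of_periodMultiset_eq p hα hq hc k hmul]
      unfold CyclotomicCode.periodMonomial
      push_cast
      ring
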